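/- Let $X$ be a compact Kähler manifold of complex dimension $n\ge 2$ with Kähler metric $g$ and Kähler form $\omega=\sqrt{-1}\sum_{\alpha,\beta} g_{\alpha\bar\beta}\,dz^\alpha\wedge d\bar z^\beta$. Let $(E,\phi)$ be a Higgs bundle over $X$, that is, a holomorphic vector bundle $E$ of finite rank with a holomorphic $\mathrm{End}\,E$-valued $(1,0)$-form $\phi$ such that $\phi\wedge\phi=0$, and let $h$ be a smooth Hermitian metric on $E$. Let $D_h$ be the Chern connection of $(E,h)$, $R_h$ its curvature, and $\phi^*_h$ the adjoint of $\phi$, i.e. the $\mathrm{End}\,E$-valued $(0,1)$-form with $h(\phi^*_h s,s')=h(s,\phi s')$. Let $\mathcal R^{1,1}_h$ be the $(1,1)$-part of the curvature $\mathcal R_h$ of the Hitchin–Simpson connection $D_h+\phi+\phi^*_h$, let $\mathcal K_h=\sqrt{-1}\Lambda\mathcal R_h=\sum_{\alpha,\beta} g^{\alpha\bar\beta}(\mathcal R_h)_{\alpha\bar\beta}$ be its mean curvature, and let $[\phi,\phi^*_h]=\phi\wedge\phi^*_h+\phi^*_h\wedge\phi$. Let $c_k(E,h)$ denote the Chern forms,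 defined by $\det\bigl(I+\tfrac{\sqrt{-1}}{2\pi}R_h\bigr)=1+c_1(E,h)+c_2(E,h)+\cdots$. Put $$\mathcal I(h)=\frac12\int_X|\mathcal R^{1,1}_h|^2\,\omega^n,\qquad \mathcal J(h)=\frac12\int_X|\mathcal K_h|^2\,\omega^n,$$ where $|\mathcal K_h|^2=\mathrm{tr}(\mathcal K_h\circ(\mathcal K_h)^*_h)$ and $|\mathcal R^{1,1}_h|^2$ is the pointwise squared norm induced by $g$ and $h$ (the sum of the squared absolute values of the components $(\mathcal R_h)^i_{j\alpha\bar\beta}$ in unitary frames). Then $$\mathcal I(h)-\mathcal J(h)=2\pi^2n(n-1)\int_X\bigl(2\,c_2(E,h)-c_1(E,h)^2\bigr)\wedge\omega^{n-2}+n(n-1)\int_X\mathrm{tr}\bigl(\mathcal R^{1,1}_h\wedge[\phi,\phi^*_h]\bigr)\wedge\omega^{n-2}.$$ -/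

import Mathlib

open scoped Manifold ContDiff

noncomputable section

namespace HiggsKahler

/-! ### Exterior algebra of complex-valued forms on `ℂⁿ`, and Wirtinger derivatives -/

/-- Complex-valued real-linear forms on `ℂⁿ`, i.e. the complexified cotangent space. -/
abbrev Cotangent (n : ℕ) : Type := (Fin n → ℂ) →ₗ[ℝ] ℂ

/-- Complex-valued alternating forms (of all degrees) at a point of `ℂⁿ`. The wedge product is
the product of this algebra. -/
abbrev Forms (n : ℕ) : Type := ExteriorAlgebra ℂ (Cotangent n)

/-- The coordinate `1`-forms: index `Sum.inl α` is `dz^α`, index `Sum.inr α` is `d\bar z^α`. -/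
def dCoord {n : ℕ} : Fin n ⊕ Fin n → Forms n
  | Sum.inl α => ExteriorAlgebra.ι ℂ (LinearMap.proj (R := ℝ) (φ := fun _ : Fin n => ℂ) α)
  | Sum.inr α => ExteriorAlgebra.ι ℂ
      (Complex.conjAe.toLinearMap ∘ₗ LinearMap.proj (R := ℝ) (φ := fun _ : Fin n => ℂ) α)

/-- The Wirtinger derivatives: index `Sum.inl α` is `∂/∂z^α = ½(∂/∂x^α - i ∂/∂y^α)`,
index `Sum.inr α` is `∂/∂\bar z^α = ½(∂/∂x^α + i ∂/∂y^α)`. -/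
def wirtinger {n : ℕ} (a : Fin n ⊕ Fin n) (f : (Fin n → ℂ) → ℂ) (z : Fin n → ℂ) : ℂ :=
  match a with
  | Sum.inl α => (1 / 2) *
      (fderiv ℝ f z (Pi.single α 1) - Complex.I * fderiv ℝ f z (Pi.single α Complex.I))
  | Sum.inr α => (1 / 2) *
      (fderiv ℝ f z (Pi.single α 1) + Complex.I * fderiv ℝ f z (Pi.single α Complex.I))

/-- Entrywise Wirtinger derivative of a matrix-valued function. -/
def wirtingerMat {n r : ℕ} (a : Fin n ⊕ Fin n) (M : (Fin n → ℂ) → Matrix (Fin r) (Fin r) ℂ)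
    (z : Fin n → ℂ) : Matrix (Fin r) (Fin r) ℂ :=
  Matrix.of fun k l => wirtinger a (fun w => M w k l) z

/-- The oriented real basis `∂/∂x¹, ∂/∂y¹, …, ∂/∂xⁿ, ∂/∂yⁿ` of `ℂⁿ`. -/
def realBasis (n : ℕ) (b : Fin (n * 2)) : Fin n → ℂ :=
  Pi.single (finProdFinEquiv.symm b).1 (![1, Complex.I] (finProdFinEquiv.symm b).2)

/-- The coefficient of `dx¹ ∧ dy¹ ∧ … ∧ dxⁿ ∧ dyⁿ` in the degree `2n` part of a form: the value
of that part on the oriented real basis, where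
`(λ₁ ∧ … ∧ λ_{2n})(v₁, …, v_{2n}) = det (λ_a (v_b))`. -/
def topCoeff (n : ℕ) : Forms n →ₗ[ℂ] ℂ :=
  ExteriorAlgebra.liftAlternating (R := ℂ) (M := Cotangent n) (N := ℂ)
    (Pi.single (M := fun k => Cotangent n [⋀^Fin k]→ₗ[ℂ] ℂ) (n * 2)
      ((Matrix.detRowAlternating (n := Fin (n * 2)) (R := ℂ)).compLinearMap
        (LinearMap.pi fun b =>
          ({ toFun := fun l => l (realBasis n b)
             map_add' := fun _ _ => rfl
             map_smul' := fun _ _ => rfl } : Cotangent n →ₗ[ℂ] ℂ))))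

/-! ### Matrix-valued forms

In a frame `f_1, …, f_r` an endomorphism-valued form is a matrix of forms; the product of such
matrices composes endomorphisms and wedges forms. -/

/-- The matrix of `1`-forms `∑_a A_a dζ^a`, with `ζ = (z, \bar z)`. -/
def oneForm {n r : ℕ} (A : Fin n ⊕ Fin n → Matrix (Fin r) (Fin r) ℂ) :
    Matrix (Fin r) (Fin r) (Forms n) :=
  Matrix.of fun k l => ∑ a, A a k l • dCoord a

/-- The matrix of `2`-forms `½ ∑_{a,b} F_{ab} dζ^a ∧ dζ^b`, for `F` antisymmetric in `a, b`. -/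
def twoForm {n r : ℕ} (F : Fin n ⊕ Fin n → Fin n ⊕ Fin n → Matrix (Fin r) (Fin r) ℂ) :
    Matrix (Fin r) (Fin r) (Forms n) :=
  Matrix.of fun k l => (1 / 2 : ℂ) • ∑ a, ∑ b, F a b k l • (dCoord a * dCoord b)

/-- The `(1,1)`-part `∑_{α,β} F_{α \bar β} dz^α ∧ d\bar z^β` of `½ ∑_{a,b} F_{ab} dζ^a ∧ dζ^b`. -/
def twoForm11 {n r : ℕ} (F : Fin n ⊕ Fin n → Fin n ⊕ Fin n → Matrix (Fin r) (Fin r) ℂ) :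
    Matrix (Fin r) (Fin r) (Forms n) :=
  Matrix.of fun k l => ∑ α, ∑ β,
    F (Sum.inl α) (Sum.inr β) k l • (dCoord (Sum.inl α) * dCoord (Sum.inr β))

/-- The components `F_{ab} = ∂_a A_b - ∂_b A_a + A_a A_b - A_b A_a` of the curvature
`dA + A ∧ A` of the connection `d + A`, `A = ∑_a A_a dζ^a`. -/
def curvature {n r : ℕ} (A : Fin n ⊕ Fin n → (Fin n → ℂ) → Matrix (Fin r) (Fin r) ℂ)
    (z : Fin n → ℂ) (a b : Fin n ⊕ Fin n) : Matrix (Fin r) (Fin r) ℂ :=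
  wirtingerMat a (A b) z - wirtingerMat b (A a) z + A a z * A b z - A b z * A a z

/-- The `k`-th Chern form of a matrix `Ω` of curvature `2`-forms, that is, the degree `2k` part of
`det (1 + (i/2π) Ω)`:
`((i/2π)^k / k!) ∑_{j_1, …, j_k} ∑_σ sgn σ Ω^{j_1}_{j_{σ 1}} ∧ … ∧ Ω^{j_k}_{j_{σ k}}`. -/
def chernForm {n r : ℕ} (k : ℕ) (Ω : Matrix (Fin r) (Fin r) (Forms n)) : Forms n :=
  ((Complex.I / (2 * Real.pi)) ^ k / (k.factorial : ℂ)) •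
    ∑ j : Fin k → Fin r, ∑ σ : Equiv.Perm (Fin k),
      (((Equiv.Perm.sign σ : ℤˣ) : ℤ) : ℂ) •
        (List.ofFn fun a => Ω (j a) (j (σ a))).prod

/-! ### Bundles, metrics, Higgs fields

`X` is a complex manifold modelled on `ℂⁿ`. For each `i : X` we use the chart at `i` and the
local trivialization at `i`; these holomorphic charts and frames cover `X`. -/

section Bundle

variable {n r : ℕ} {X : Type*} [TopologicalSpace X] [ChartedSpace (Fin n → ℂ) X]
  (V : X → Type*) [TopologicalSpace (Bundle.TotalSpace (Fin r → ℂ) V)]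
  [∀ x, AddCommGroup (V x)] [∀ x, Module ℂ (V x)] [∀ x, TopologicalSpace (V x)]
  [FiberBundle (Fin r → ℂ) V]

/-- The local frame `f_1, …, f_r` of `V` given by the trivialization at `i`. For the tangent
bundle this is the coordinate frame `∂/∂z¹, …, ∂/∂zⁿ` of the chart at `i`. -/
def frame (i x : X) (k : Fin r) : V x :=
  (trivializationAt (Fin r → ℂ) V i).symm x (Pi.single k 1)

variable (n r) in
/-- The open set of `X` on which both the chart and the frame at `i` are defined. -/
def patch (i : X) : Set X :=
  (chartAt (Fin n → ℂ) i).source ∩ (trivializationAt (Fin r → ℂ) V i).baseSet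

variable (n r) in
/-- The image of the patch at `i` in `ℂⁿ` under the chart at `i`. -/
def patchImage (i : X) : Set (Fin n → ℂ) :=
  (chartAt (Fin n → ℂ) i).target ∩
    (chartAt (Fin n → ℂ) i).symm ⁻¹' (trivializationAt (Fin r → ℂ) V i).baseSet

variable (n r) in
/-- A smooth Hermitian metric on `V`, linear in the first variable and conjugate-linear in the
second. Smoothness is that of the coefficients `h(f_k, f_l)` as functions of the real
coordinates. -/
structure HermitianMetric where
  form : ∀ x : X, V x →ₗ[ℂ] V x →ₗ⋆[ℂ] ℂ
  conj_symm : ∀ (x : X) (u v : V x), (starRingEnd ℂ) (form x u v) = form x v u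
  pos : ∀ (x : X) (u : V x), u ≠ 0 → 0 < (form x u u).re
  smooth : ∀ (i : X) (k l : Fin r), ContDiffOn ℝ ∞
    (fun z : Fin n → ℂ => form ((chartAt (Fin n → ℂ) i).symm z)
      (frame V i ((chartAt (Fin n → ℂ) i).symm z) k)
      (frame V i ((chartAt (Fin n → ℂ) i).symm z) l)) (patchImage n r V i)

variable {V}

/-- The Gram matrix `G_{kl} = h(f_l, f_k)` in the chart and frame at `i`; thus
`h(s, t) = \bar tᵀ G s` for column vectors `s, t` of components. -/
def HermitianMetric.gram (h : HermitianMetric n r V) (i : X) (z : Fin n → ℂ) :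
    Matrix (Fin r) (Fin r) ℂ :=
  Matrix.of fun k l => h.form ((chartAt (Fin n → ℂ) i).symm z)
    (frame V i ((chartAt (Fin n → ℂ) i).symm z) l)
    (frame V i ((chartAt (Fin n → ℂ) i).symm z) k)

/-- The matrix of the adjoint of the endomorphism with matrix `M`, with respect to the Hermitian
form with Gram matrix `G`: `h(M^* s, t) = h(s, M t)`. -/
def adjointMat (G M : Matrix (Fin r) (Fin r) ℂ) : Matrix (Fin r) (Fin r) ℂ :=
  G⁻¹ * M.conjTranspose * G

/-- The Chern connection of `(V, h)`: in a holomorphic frame it is `d + G⁻¹ ∂G`, the unique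
connection compatible with `h` whose `(0,1)`-part is `\bar∂`. -/
def HermitianMetric.chernConnection (h : HermitianMetric n r V) (i : X) :
    Fin n ⊕ Fin n → (Fin n → ℂ) → Matrix (Fin r) (Fin r) ℂ
  | Sum.inl α => fun z => (h.gram i z)⁻¹ * wirtingerMat (Sum.inl α) (h.gram i) z
  | Sum.inr _ => fun _ => 0

/-- The curvature `R_h` of the Chern connection, as a matrix of `2`-forms. -/
def HermitianMetric.chernCurvature (h : HermitianMetric n r V) (i : X) (z : Fin n → ℂ) :
    Matrix (Fin r) (Fin r) (Forms n) :=
  twoForm (curvature (h.chernConnection i) z)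

variable [IsManifold 𝓘(ℂ, Fin n → ℂ) ω X]

variable (n X) in
/-- A Kähler metric on `X`: a Hermitian metric on the holomorphic tangent bundle, with
coefficients `g_{α \bar β} = g(∂/∂z^α, ∂/∂z^β)`, whose Kähler form
`i ∑ g_{α \bar β} dz^α ∧ d\bar z^β` is closed, i.e.
`∂g_{α \bar β}/∂z^γ = ∂g_{γ \bar β}/∂z^α`. -/
structure KahlerMetric extends
    HermitianMetric n n (TangentSpace 𝓘(ℂ, Fin n → ℂ) : X → Type) where
  closed : ∀ (i : X), ∀ z ∈ (chartAt (Fin n → ℂ) i).target, ∀ α β γ : Fin n,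
    wirtinger (Sum.inl γ) (fun w => toHermitianMetric.gram i w β α) z =
      wirtinger (Sum.inl α) (fun w => toHermitianMetric.gram i w β γ) z

/-- The Kähler form `ω = i ∑ g_{α \bar β} dz^α ∧ d\bar z^β` in the chart at `i`. -/
def KahlerMetric.kahlerForm (g : KahlerMetric n X) (i : X) (z : Fin n → ℂ) : Forms n :=
  Complex.I • ∑ α, ∑ β, g.gram i z β α • (dCoord (Sum.inl α) * dCoord (Sum.inr β))

/-- The inverse metric `g^{α \bar β}`, normalized by `∑_β g^{α \bar β} g_{γ \bar β} = δ^α_γ`. -/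
def KahlerMetric.inv (g : KahlerMetric n X) (i : X) (z : Fin n → ℂ) (α β : Fin n) : ℂ :=
  (g.gram i z)⁻¹ α β

variable (n r V) in
/-- A Higgs field on `V`: a holomorphic `(1,0)`-form `φ` with values in the endomorphisms of `V`,
such that `φ ∧ φ = 0`. Holomorphy is that of the coefficients of `φ` in the charts and frames. -/
structure HiggsField where
  toFun : ∀ x : X, TangentSpace 𝓘(ℂ, Fin n → ℂ) x →ₗ[ℂ] Module.End ℂ (V x)
  holomorphic : ∀ (i : X) (α : Fin n) (k l : Fin r), DifferentiableOn ℂ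
    (fun z : Fin n → ℂ => (trivializationAt (Fin r → ℂ) V i
      ⟨(chartAt (Fin n → ℂ) i).symm z,
        toFun ((chartAt (Fin n → ℂ) i).symm z)
          (frame (TangentSpace 𝓘(ℂ, Fin n → ℂ) : X → Type) i
            ((chartAt (Fin n → ℂ) i).symm z) α)
          (frame V i ((chartAt (Fin n → ℂ) i).symm z) l)⟩).2 k) (patchImage n r V i)
  wedge_self : ∀ (x : X) (u v : TangentSpace 𝓘(ℂ, Fin n → ℂ) x),
    toFun x u * toFun x v = toFun x v * toFun x u

/-- The matrices `φ_α` of the local expression `φ = ∑_α φ_α dz^α` in the chart and frame at `i`. -/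
def HiggsField.mat (φ : HiggsField n r V) (i : X) (α : Fin n) (z : Fin n → ℂ) :
    Matrix (Fin r) (Fin r) ℂ :=
  Matrix.of fun k l => (trivializationAt (Fin r → ℂ) V i
    ⟨(chartAt (Fin n → ℂ) i).symm z,
      φ.toFun ((chartAt (Fin n → ℂ) i).symm z)
        (frame (TangentSpace 𝓘(ℂ, Fin n → ℂ) : X → Type) i
          ((chartAt (Fin n → ℂ) i).symm z) α)
        (frame V i ((chartAt (Fin n → ℂ) i).symm z) l)⟩).2 k

/-- The Higgs field as a matrix of `1`-forms: `φ = ∑_α φ_α dz^α`. -/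
def HiggsField.formMat (φ : HiggsField n r V) (i : X) (z : Fin n → ℂ) :
    Matrix (Fin r) (Fin r) (Forms n) :=
  oneForm (Sum.elim (fun α => φ.mat i α z) fun _ => 0)

/-- The adjoint of the Higgs field as a matrix of `1`-forms:
`φ^*_h = ∑_α (φ_α)^* d\bar z^α`. -/
def HiggsField.adjointFormMat (φ : HiggsField n r V) (h : HermitianMetric n r V) (i : X)
    (z : Fin n → ℂ) : Matrix (Fin r) (Fin r) (Forms n) :=
  oneForm (Sum.elim (fun _ => 0) fun α => adjointMat (h.gram i z) (φ.mat i α z))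

/-- `[φ, φ^*_h] = φ ∧ φ^*_h + φ^*_h ∧ φ`. -/
def HiggsField.bracket (φ : HiggsField n r V) (h : HermitianMetric n r V) (i : X)
    (z : Fin n → ℂ) : Matrix (Fin r) (Fin r) (Forms n) :=
  φ.formMat i z * φ.adjointFormMat h i z + φ.adjointFormMat h i z * φ.formMat i z

/-- The Hitchin–Simpson connection `D_h + φ + φ^*_h`. -/
def HiggsField.hsConnection (φ : HiggsField n r V) (h : HermitianMetric n r V) (i : X) :
    Fin n ⊕ Fin n → (Fin n → ℂ) → Matrix (Fin r) (Fin r) ℂ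
  | Sum.inl α => fun z => h.chernConnection i (Sum.inl α) z + φ.mat i α z
  | Sum.inr α => fun z =>
      h.chernConnection i (Sum.inr α) z + adjointMat (h.gram i z) (φ.mat i α z)

/-- The components of the Hitchin–Simpson curvature. -/
def HiggsField.hsCurvature (φ : HiggsField n r V) (h : HermitianMetric n r V) (i : X)
    (z : Fin n → ℂ) (a b : Fin n ⊕ Fin n) : Matrix (Fin r) (Fin r) ℂ :=
  curvature (φ.hsConnection h i) z a b

/-- The `(1,1)`-part `ℛ^{1,1}_h` of the Hitchin–Simpson curvature, as a matrix of `2`-forms. -/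
def HiggsField.curvature11 (φ : HiggsField n r V) (h : HermitianMetric n r V) (i : X)
    (z : Fin n → ℂ) : Matrix (Fin r) (Fin r) (Forms n) :=
  twoForm11 (φ.hsCurvature h i z)

/-- The Hitchin–Simpson mean curvature `𝒦_h = i Λ ℛ_h`; since `i Λ (dz^α ∧ d\bar z^β) = g^{α \bar β}`,
it is `∑ g^{α \bar β} (ℛ_h)_{α \bar β}`. -/
def HiggsField.meanCurvature (φ : HiggsField n r V) (g : KahlerMetric n X)
    (h : HermitianMetric n r V) (i : X) (z : Fin n → ℂ) : Matrix (Fin r) (Fin r) ℂ :=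
  ∑ α, ∑ β, g.inv i z α β • φ.hsCurvature h i z (Sum.inl α) (Sum.inr β)

/-- The squared norm `|𝒦_h|² = tr (𝒦_h ∘ 𝒦_h^*)`. -/
def HiggsField.meanCurvatureNormSq (φ : HiggsField n r V) (g : KahlerMetric n X)
    (h : HermitianMetric n r V) (i : X) (z : Fin n → ℂ) : ℂ :=
  (φ.meanCurvature g h i z *
    adjointMat (h.gram i z) (φ.meanCurvature g h i z)).trace

/-- The squared norm `|ℛ^{1,1}_h|²` for the Hermitian metrics `g` and `h`:
`∑ g^{α \bar γ} g^{δ \bar β} tr (ℛ_{α \bar β} ∘ (ℛ_{γ \bar δ})^*)`; in unitary frames of the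
tangent bundle and of `V` this is the sum of the squared absolute values of all components. -/
def HiggsField.curvature11NormSq (φ : HiggsField n r V) (g : KahlerMetric n X)
    (h : HermitianMetric n r V) (i : X) (z : Fin n → ℂ) : ℂ :=
  ∑ α, ∑ β, ∑ γ, ∑ δ, g.inv i z α γ * g.inv i z δ β *
    (φ.hsCurvature h i z (Sum.inl α) (Sum.inr β) *
      adjointMat (h.gram i z) (φ.hsCurvature h i z (Sum.inl γ) (Sum.inr δ))).trace

end Bundle

/-! ### Integration -/

section Integral

variable {n r : ℕ} {X : Type*} [TopologicalSpace X] [ChartedSpace (Fin n → ℂ) X]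
  (V : X → Type*) [TopologicalSpace (Bundle.TotalSpace (Fin r → ℂ) V)]
  [∀ x, AddCommGroup (V x)] [∀ x, Module ℂ (V x)] [∀ x, TopologicalSpace (V x)]
  [FiberBundle (Fin r → ℂ) V] [CompactSpace X] [T2Space X]

set_option linter.unusedSectionVars false in
variable (n r) in
theorem exists_partition : ∃ ρ : PartitionOfUnity X X Set.univ,
    ρ.IsSubordinate (fun i => patch n r V i) :=
  PartitionOfUnity.exists_isSubordinate isClosed_univ _
    (fun i => (chartAt (Fin n → ℂ) i).open_source.inter
      (trivializationAt (Fin r → ℂ) V i).open_baseSet)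
    (fun x _ => Set.mem_iUnion.2
      ⟨x, mem_chart_source _ x, FiberBundle.mem_baseSet_trivializationAt' x⟩)

variable (n r) in
/-- A partition of unity subordinate to the cover of `X` by the patches. -/
def partition : PartitionOfUnity X X Set.univ := (exists_partition n r V).choose

variable (n r) in
/-- The integral over `X` (with its complex orientation) of the top-degree part of a differential
form, given by its local expressions `η i z` in the patches `i : X`:
`∑_i ∫ ρ_i η_i`, for a partition of unity `ρ` subordinate to the patches. It is applied below to
scalar expressions that are invariant under changes of holomorphic coordinates and frames, i.e. to
local expressions of a global form, for which it does not depend on `ρ`. -/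
def integral (η : X → (Fin n → ℂ) → Forms n) : ℂ :=
  ∑ᶠ i : X, ∫ z in patchImage n r V i,
    ((partition n r V i ((chartAt (Fin n → ℂ) i).symm z) : ℝ) : ℂ) * topCoeff n (η i z)

variable {V} [IsManifold 𝓘(ℂ, Fin n → ℂ) ω X]

/-- `𝒥(h) = ½ ∫_X |𝒦_h|² ωⁿ`. -/
def HiggsField.functionalJ (φ : HiggsField n r V) (g : KahlerMetric n X)
    (h : HermitianMetric n r V) : ℂ :=
  (1 / 2) * integral n r V fun i z => φ.meanCurvatureNormSq g h i z • g.kahlerForm i z ^ n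

/-- `ℐ(h) = ½ ∫_X |ℛ^{1,1}_h|² ωⁿ`. -/
def HiggsField.functionalI (φ : HiggsField n r V) (g : KahlerMetric n X)
    (h : HermitianMetric n r V) : ℂ :=
  (1 / 2) * integral n r V fun i z => φ.curvature11NormSq g h i z • g.kahlerForm i z ^ n

end Integral

end HiggsKahler

end

noncomputable section

namespace HiggsKahler

/-! ### Exterior algebra -/

/-! ### Powers of sums of commuting square-zero elements. -/

section NilpotentSums

variable {A : Type*} [Ring A]

/-! The identity holds pointwise, before integration, and rests on three algebraic facts. Write R
for the Chern curvature, B for the bracket [φ, φ*] and ℛ for the (1,1)-part of the Hitchin–Simpson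
curvature.

(a) A Riemann-bilinear contraction: n(n-1) tr(ℛ∧ℛ)∧ω^(n-2) = (|ℛ|² - |𝒦|²) ωⁿ. Since ω is i times a
sum of n commuting square-zero 2-forms, dz^α∧dz̄^β∧dz^γ∧dz̄^δ∧ω^(n-2) is an explicit multiple of ωⁿ
(`wedge_mul_sum_pow`, `dCoord_wedge_pow`). The two resulting contractions of tr(ℛ_{αβ̄} ℛ_{γδ̄}) are
|ℛ|² and |𝒦|², because the adjoint of ℛ_{αβ̄} is ℛ_{βᾱ} (`HiggsField.adjointMat_hsCurvature`).

(b) ℛ = R + B (`HiggsField.curvature11_eq_add`), as φ is holomorphic and φ* is parallel in the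
(1,0)-directions. The graded cyclicity of the trace together with φ∧φ = 0 gives tr(B∧B) = 0, so
tr(ℛ∧ℛ) = tr(R∧R) + 2 tr(ℛ∧B) (`HiggsField.trace_curvature11_sq`).

(c) 2c₂ - c₁² = tr(R∧R)/4π² (`two_chernForm_two_sub`).

The factor ½ in both functionals turns 4π² into 2π² and 2 tr(ℛ∧B) into tr(ℛ∧B). Integration
contributes only linearity, for which the local integrands must be continuous on the patches. -/

theorem add_pow_succ_of_mul_self_eq_zero {x y : A} (hc : Commute x y) (hx : x * x = 0) (k : ℕ) :
    (x + y) ^ (k + 1) = y ^ (k + 1) + (k + 1) • (x * y ^ k) := by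
  induction k with
  | zero => simp [add_comm]
  | succ k ih =>
    have h1 : x * y ^ k * x = 0 := by
      rw [mul_assoc, ← (hc.pow_right k).eq, ← mul_assoc, hx, zero_mul]
    rw [pow_succ, ih, add_mul, mul_add, smul_mul_assoc, mul_add, h1, zero_add, mul_assoc x,
      ← pow_succ, ← (hc.pow_right (k + 1)).eq, ← pow_succ, succ_nsmul (x * y ^ (k + 1)) (k + 1)]
    abel

variable {ι : Type*} [DecidableEq ι] {p : ι → A} (hc : ∀ i j, Commute (p i) (p j))
  (hs : ∀ i, p i * p i = 0)

include hc hs in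
-- By pigeonhole, every monomial of degree `S.card + 1` repeats some square-zero factor.
theorem sum_pow_card_succ_eq_zero (S : Finset ι) : (∑ i ∈ S, p i) ^ (S.card + 1) = 0 := by
  induction S using Finset.induction_on with
  | empty => simp
  | insert a S ha ih =>
    rw [Finset.sum_insert ha, add_pow_succ_of_mul_self_eq_zero
      (Commute.sum_right _ _ _ fun i _ => hc a i) (hs a), Finset.card_insert_of_notMem ha, ih,
      pow_succ, ih]
    simp

include hc hs in
theorem sum_insert_pow_card (S : Finset ι) {a : ι} (ha : a ∉ S) :
    (∑ i ∈ insert a S, p i) ^ (S.card + 1) = (S.card + 1) • (p a * (∑ i ∈ S, p i) ^ S.card) := by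
  rw [Finset.sum_insert ha, add_pow_succ_of_mul_self_eq_zero
    (Commute.sum_right _ _ _ fun i _ => hc a i) (hs a), sum_pow_card_succ_eq_zero hc hs, zero_add]

include hc in
-- Summands killed by `x` can be dropped from the power: after one factor is absorbed into `x`, the
-- new left factor is still killed by them, by commutativity.
theorem mul_sum_pow_of_annihilates [Fintype ι] (T : Finset ι) (k : ℕ) {x : A}
    (hx : ∀ i ∈ T, x * p i = 0) :
    x * (∑ i, p i) ^ k = x * (∑ i ∈ Tᶜ, p i) ^ k := by
  induction k generalizing x with
  | zero => simp
  | succ k ih =>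
    have h1 : x * ∑ i, p i = x * ∑ i ∈ Tᶜ, p i := by
      rw [← Finset.sum_add_sum_compl T, mul_add, Finset.mul_sum,
        Finset.sum_eq_zero hx, zero_add]
    rw [pow_succ', pow_succ', ← mul_assoc, ← mul_assoc, h1]
    refine ih fun i hi => ?_
    rw [mul_assoc, (Commute.sum_left _ _ _ fun j _ => hc j i : Commute (∑ j ∈ Tᶜ, p j) (p i)).eq,
      ← mul_assoc, hx i hi, zero_mul]

end NilpotentSums

/-! ### Contraction of four 1-forms against powers of a 2-form. -/

section Wedge

variable {M : Type*} [AddCommGroup M] [Module ℂ M]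

local notation "ε" => ExteriorAlgebra.ι ℂ (M := M)

theorem ι_mul_swap (x y : M) : ε x * ε y = -(ε y * ε x) :=
  eq_neg_of_add_eq_zero_left (ExteriorAlgebra.ι_add_mul_swap x y)

theorem commute_ι_mul_ι (x y z : M) : Commute (ε x * ε y) (ε z) := by
  change ε x * ε y * ε z = ε z * (ε x * ε y)
  rw [mul_assoc, ι_mul_swap y z, mul_neg, ← mul_assoc, ι_mul_swap x z, neg_mul, neg_neg, mul_assoc]

theorem ι_mul_ι_mul_self_left (x y : M) : ε x * (ε x * ε y) = 0 := by
  rw [← mul_assoc, ExteriorAlgebra.ι_sq_zero, zero_mul]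

theorem ι_mul_ι_mul_self_right (x y : M) : ε y * (ε x * ε y) = 0 := by
  rw [← (commute_ι_mul_ι x y y).eq, mul_assoc, ExteriorAlgebra.ι_sq_zero, mul_zero]

/-- With p_i = a_i∧b_i, every p_i whose index occurs among α, β, γ, δ is killed by the four-fold
product. If three distinct indices occur, at most n-3 of the p_i survive and their sum to the power
n-2 vanishes. The remaining nonzero cases are ±p_α p_γ with α ≠ γ, the minus sign coming from
exchanging the two b's. -/
theorem wedge_mul_sum_pow {n : ℕ} (hn : 2 ≤ n) (a b : Fin n → M) (α β γ δ : Fin n) :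
    (n * (n - 1) : ℂ) • (ε (a α) * ε (b β) * (ε (a γ) * ε (b δ)) *
        (∑ i, ε (a i) * ε (b i)) ^ (n - 2)) =
      ((if α = β ∧ γ = δ then 1 else 0) - (if α = δ ∧ γ = β then 1 else 0) : ℂ) •
        (∑ i, ε (a i) * ε (b i)) ^ n := by
  obtain ⟨m, rfl⟩ : ∃ m, n = m + 2 := ⟨n - 2, by omega⟩
  rw [Nat.add_sub_cancel]
  set p : Fin (m + 2) → ExteriorAlgebra ℂ M := fun i => ε (a i) * ε (b i) with hp
  have hpc : ∀ i (x : M), Commute (p i) (ε x) := fun i x => commute_ι_mul_ι _ _ x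
  have hc : ∀ i j, Commute (p i) (p j) := fun i j => (hpc i _).mul_right (hpc i _)
  have hap : ∀ i, ε (a i) * p i = 0 := fun i => ι_mul_ι_mul_self_left _ _
  have hbp : ∀ i, ε (b i) * p i = 0 := fun i => ι_mul_ι_mul_self_right _ _
  have hs : ∀ i, p i * p i = 0 := fun i => by
    conv_lhs => enter [1]; rw [hp]
    rw [mul_assoc, hbp, mul_zero]
  -- Peeling off p_i and then p_j produces the factors m+2 and m+1; the m remaining summands can be
  -- completed to the full sum since p_i p_j kills the two extra ones.
  have hpow : ∀ i j, i ≠ j → (∑ i, p i) ^ (m + 2) =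
      ((m + 2 : ℕ) * (m + 1 : ℕ) : ℂ) • (p i * p j * (∑ l, p l) ^ m) := by
    intro i j hij
    have h1 : (({i, j} : Finset (Fin (m + 2)))ᶜ).card = m := by
      rw [Finset.card_compl, Finset.card_pair hij]; simp
    have h2 : insert j (({i, j} : Finset (Fin (m + 2)))ᶜ) = {i}ᶜ := by
      ext l; simp only [Finset.mem_insert, Finset.mem_compl, Finset.mem_singleton]
      grind
    have h3 : (({i} : Finset (Fin (m + 2)))ᶜ).card = m + 1 := by
      rw [Finset.card_compl]; simp
    have h4 := sum_insert_pow_card hc hs ({i}ᶜ) (a := i) (by simp)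
    have h5 := sum_insert_pow_card hc hs (({i, j} : Finset (Fin (m + 2)))ᶜ) (a := j) (by simp)
    rw [h1, h2] at h5
    rw [h3, h5, Finset.insert_compl_self] at h4
    rw [mul_sum_pow_of_annihilates hc {i, j} m, h4, mul_assoc (p i) (p j), mul_smul,
      mul_smul_comm, ← Nat.cast_smul_eq_nsmul ℂ, ← Nat.cast_smul_eq_nsmul ℂ]
    intro l hl
    rcases Finset.mem_insert.1 hl with rfl | hl
    · rw [mul_assoc, (hc j l).eq, ← mul_assoc, hs, zero_mul]
    · rw [Finset.mem_singleton.1 hl, mul_assoc, hs, mul_zero]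
  have hcast : ((m + 2 : ℕ) * ((m + 2 : ℕ) - 1) : ℂ) = ((m + 2 : ℕ) * (m + 1 : ℕ) : ℂ) := by
    push_cast; ring
  rw [hcast]
  by_cases hαγ : α = γ
  · subst hαγ
    have h0 : ε (a α) * ε (b β) * (ε (a α) * ε (b δ)) = 0 := by
      rw [← mul_assoc, (commute_ι_mul_ι _ _ _).eq, ι_mul_ι_mul_self_left, zero_mul]
    rw [h0]
    have : (α = β ∧ α = δ) ↔ (α = δ ∧ α = β) := and_comm
    simp [this]
  by_cases h1 : α = β ∧ γ = δ
  · obtain ⟨rfl, rfl⟩ := h1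
    rw [hpow α γ hαγ]
    simp [hαγ, hp]
  by_cases h2 : α = δ ∧ γ = β
  · obtain ⟨rfl, rfl⟩ := h2
    have h3 : ε (a α) * ε (b γ) * (ε (a γ) * ε (b α)) = -(p α * p γ) := by
      rw [mul_assoc, ← mul_assoc (ε (b γ)), ι_mul_swap (b γ), neg_mul, mul_neg,
        (commute_ι_mul_ι (a γ) (b γ) (b α)).eq, ← mul_assoc]
    rw [hpow α γ hαγ, h3]
    simp [hαγ, Ne.symm hαγ]
  rw [if_neg h1, if_neg h2, sub_zero, zero_smul]
  -- The even element p_i commutes past the 1-forms until it meets the a_i or b_i with the same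
  -- index.
  have hx : ∀ i ∈ ({α, β, γ, δ} : Finset (Fin (m + 2))),
      ε (a α) * ε (b β) * (ε (a γ) * ε (b δ)) * p i = 0 := by
    intro i hi
    simp only [Finset.mem_insert, Finset.mem_singleton] at hi
    have c := fun x => (hpc i x).eq.symm
    rcases hi with rfl | rfl | rfl | rfl
    · rw [mul_assoc, mul_assoc, mul_assoc, c, ← mul_assoc _ (p i), c, mul_assoc, ← mul_assoc _ (p i), c,
        mul_assoc, ← mul_assoc, hap, zero_mul]
    · rw [mul_assoc, mul_assoc, mul_assoc, c, ← mul_assoc _ (p i), c, mul_assoc, ← mul_assoc _ (p i), hbp,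
        zero_mul, mul_zero]
    · rw [mul_assoc, mul_assoc, mul_assoc, c, ← mul_assoc _ (p i), hap, zero_mul, mul_zero, mul_zero]
    · rw [mul_assoc, mul_assoc, mul_assoc, hbp, mul_zero, mul_zero, mul_zero]
  rw [mul_sum_pow_of_annihilates hc _ m hx]
  by_cases hβδ : β = δ
  · subst hβδ
    have h0 : ε (a α) * ε (b β) * (ε (a γ) * ε (b β)) = 0 := by
      rw [mul_assoc, ι_mul_ι_mul_self_right, mul_zero]
    rw [h0, zero_mul, smul_zero]
  · have hcard : 3 ≤ ({α, β, γ, δ} : Finset (Fin (m + 2))).card := by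
      by_cases hβ : β = α ∨ β = γ
      · have : ({α, γ, δ} : Finset (Fin (m + 2))).card = 3 := by
          rw [Finset.card_eq_three]
          exact ⟨α, γ, δ, hαγ, by grind, by grind, rfl⟩
        rw [← this]
        exact Finset.card_le_card (by intro x; simp; grind)
      · have : ({α, β, γ} : Finset (Fin (m + 2))).card = 3 := by
          rw [Finset.card_eq_three]
          exact ⟨α, β, γ, by grind, by grind, by grind, rfl⟩
        rw [← this]
        exact Finset.card_le_card (by intro x; simp; grind)
    have hcc := Finset.card_compl ({α, β, γ, δ} : Finset (Fin (m + 2)))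
    rw [Fintype.card_fin] at hcc
    rw [pow_eq_zero_of_le (by omega) (sum_pow_card_succ_eq_zero hc hs _), mul_zero, smul_zero]

end Wedge

/-! ### Wirtinger calculus -/

section Wirtinger

variable {n r : ℕ} {f f₁ f₂ : (Fin n → ℂ) → ℂ} {z : Fin n → ℂ} {U : Set (Fin n → ℂ)}

theorem wirtinger_congr (a : Fin n ⊕ Fin n) (h : f₁ =ᶠ[nhds z] f₂) :
    wirtinger a f₁ z = wirtinger a f₂ z := by
  cases a <;> simp only [wirtinger, h.fderiv_eq]

theorem wirtinger_const (a : Fin n ⊕ Fin n) (c : ℂ) : wirtinger a (fun _ => c) z = 0 := by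
  cases a <;> simp [wirtinger]

theorem wirtinger_add (a : Fin n ⊕ Fin n) (h₁ : DifferentiableAt ℝ f₁ z)
    (h₂ : DifferentiableAt ℝ f₂ z) :
    wirtinger a (fun w => f₁ w + f₂ w) z = wirtinger a f₁ z + wirtinger a f₂ z := by
  cases a <;> simp only [wirtinger, fderiv_fun_add h₁ h₂, add_apply] <;> ring

theorem wirtinger_mul (a : Fin n ⊕ Fin n) (h₁ : DifferentiableAt ℝ f₁ z)
    (h₂ : DifferentiableAt ℝ f₂ z) :
    wirtinger a (fun w => f₁ w * f₂ w) z = wirtinger a f₁ z * f₂ z + f₁ z * wirtinger a f₂ z := by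
  cases a <;> simp only [wirtinger, fderiv_fun_mul h₁ h₂, add_apply,
    smul_apply, smul_eq_mul] <;> ring

theorem wirtinger_sum {ι : Type*} (a : Fin n ⊕ Fin n) (s : Finset ι) {F : ι → (Fin n → ℂ) → ℂ}
    (h : ∀ i ∈ s, DifferentiableAt ℝ (F i) z) :
    wirtinger a (fun w => ∑ i ∈ s, F i w) z = ∑ i ∈ s, wirtinger a (F i) z := by
  cases a <;> simp only [wirtinger, fderiv_fun_sum h, sum_apply,
    Finset.mul_sum, ← Finset.sum_sub_distrib, ← Finset.sum_add_distrib]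

/-- Conjugation is real-linear, so it passes through the real derivative and only flips the sign of
i; `Sum.swap` thus exchanges ∂ and ∂̄. -/
theorem wirtinger_conj (a : Fin n ⊕ Fin n) (h : DifferentiableAt ℝ f z) :
    wirtinger a (fun w => star (f w)) z = star (wirtinger a.swap f z) := by
  have hd : fderiv ℝ (fun w => star (f w)) z = Complex.conjCLE.toContinuousLinearMap.comp
      (fderiv ℝ f z) :=
    (Complex.conjCLE.toContinuousLinearMap.hasFDerivAt.comp z h.hasFDerivAt).fderiv
  cases a <;> simp only [wirtinger, hd] <;> simp [sub_eq_add_neg]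

theorem wirtinger_inr_of_differentiableAt (α : Fin n) (h : DifferentiableAt ℂ f z) :
    wirtinger (Sum.inr α) f z = 0 := by
  have hd : fderiv ℝ f z = (fderiv ℂ f z).restrictScalars ℝ :=
    (h.hasFDerivAt.restrictScalars ℝ).fderiv
  have h1 : (Pi.single α Complex.I : Fin n → ℂ) = Complex.I • Pi.single α 1 := by
    rw [← Pi.single_smul, smul_eq_mul, mul_one]
  simp only [wirtinger, hd, ContinuousLinearMap.coe_restrictScalars', h1, map_smul, smul_eq_mul]
  linear_combination (1 / 2 * fderiv ℂ f z (Pi.single α 1)) * Complex.I_mul_I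

theorem contDiffOn_wirtinger (a : Fin n ⊕ Fin n) (hU : IsOpen U) (h : ContDiffOn ℝ ∞ f U) :
    ContDiffOn ℝ ∞ (wirtinger a f) U := by
  have h1 : ContDiffOn ℝ ∞ (fderiv ℝ f) U := h.fderiv_of_isOpen hU le_rfl
  have h2 : ∀ v, ContDiffOn ℝ ∞ (fun w => fderiv ℝ f w v) U := fun v =>
    h1.clm_apply contDiffOn_const
  cases a
  · exact contDiffOn_const.mul ((h2 _).sub (contDiffOn_const.mul (h2 _)))
  · exact contDiffOn_const.mul ((h2 _).add (contDiffOn_const.mul (h2 _)))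

theorem wirtinger_comm (a b : Fin n ⊕ Fin n) (h : ContDiffAt ℝ ∞ f z) :
    wirtinger a (wirtinger b f) z = wirtinger b (wirtinger a f) z := by
  -- Everything reduces to the symmetry of the second real derivative, evaluated on the vectors e_α,
  -- i e_α, e_β, i e_β.
  have hsymm : IsSymmSndFDerivAt ℝ f z := h.isSymmSndFDerivAt (by simp; norm_cast)
  have hd : DifferentiableAt ℝ (fderiv ℝ f) z :=
    (h.fderiv_right (m := 1) (by norm_cast)).differentiableAt one_ne_zero
  have hv : ∀ v, HasFDerivAt (fun w => fderiv ℝ f w v) ((fderiv ℝ (fderiv ℝ f) z).flip v) z :=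
    fun v => by simpa using hd.hasFDerivAt.clm_apply (hasFDerivAt_const v z)
  have hm : ∀ v, HasFDerivAt (wirtinger (Sum.inl v) f)
      ((1 / 2 : ℂ) • ((fderiv ℝ (fderiv ℝ f) z).flip (Pi.single v 1) -
        Complex.I • (fderiv ℝ (fderiv ℝ f) z).flip (Pi.single v Complex.I))) z :=
    fun v => ((hv _).sub ((hv _).const_mul _)).const_mul _
  have hp : ∀ v, HasFDerivAt (wirtinger (Sum.inr v) f)
      ((1 / 2 : ℂ) • ((fderiv ℝ (fderiv ℝ f) z).flip (Pi.single v 1) +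
        Complex.I • (fderiv ℝ (fderiv ℝ f) z).flip (Pi.single v Complex.I))) z :=
    fun v => ((hv _).add ((hv _).const_mul _)).const_mul _
  have key : ∀ (α : Fin n) (c : ℂ) (β : Fin n) (d : ℂ),
      fderiv ℝ (fderiv ℝ f) z (Pi.single α c) (Pi.single β d) =
        fderiv ℝ (fderiv ℝ f) z (Pi.single β d) (Pi.single α c) := fun _ _ _ _ => hsymm _ _
  rcases a with α | α <;> rcases b with β | β
  all_goals
    rw [wirtinger, wirtinger]
    simp only [(hm _).fderiv, (hp _).fderiv, smul_apply,
      sub_apply, add_apply, ContinuousLinearMap.flip_apply, smul_eq_mul]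
    rw [key α 1 β 1, key α 1 β Complex.I, key α Complex.I β 1, key α Complex.I β Complex.I]
    ring

end Wirtinger

/-! ### Wirtinger derivatives of matrix-valued functions. -/

section WirtingerMat

variable {n r : ℕ} {M N : (Fin n → ℂ) → Matrix (Fin r) (Fin r) ℂ} {z : Fin n → ℂ}
  {U : Set (Fin n → ℂ)}

/-- A matrix-valued function with smooth entries on `U`. -/
def SmoothMatOn (M : (Fin n → ℂ) → Matrix (Fin r) (Fin r) ℂ) (U : Set (Fin n → ℂ)) : Prop :=
  ∀ k l, ContDiffOn ℝ ∞ (fun w => M w k l) U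

/-- A matrix-valued function with real differentiable entries at `z`. -/
def DiffMatAt (M : (Fin n → ℂ) → Matrix (Fin r) (Fin r) ℂ) (z : Fin n → ℂ) : Prop :=
  ∀ k l, DifferentiableAt ℝ (fun w => M w k l) z

theorem SmoothMatOn.diffMatAt (h : SmoothMatOn M U) (hU : IsOpen U) (hz : z ∈ U) :
    DiffMatAt M z := fun k l =>
  ((h k l).contDiffAt (hU.mem_nhds hz)).differentiableAt (by simp)

theorem SmoothMatOn.mul (hM : SmoothMatOn M U) (hN : SmoothMatOn N U) :
    SmoothMatOn (fun w => M w * N w) U := fun k l => by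
  simp only [Matrix.mul_apply]
  exact ContDiffOn.sum fun j _ => (hM k j).mul (hN j l)

theorem SmoothMatOn.wirtingerMat (hM : SmoothMatOn M U) (hU : IsOpen U) (a : Fin n ⊕ Fin n) :
    SmoothMatOn (wirtingerMat a M) U := fun k l => contDiffOn_wirtinger a hU (hM k l)

theorem SmoothMatOn.det (hM : SmoothMatOn M U) : ContDiffOn ℝ ∞ (fun w => (M w).det) U := by
  simp only [Matrix.det_apply']
  exact ContDiffOn.sum fun σ _ => contDiffOn_const.mul (contDiffOn_prod fun i _ => hM _ _)

/-- Cramer's rule: adjugate entries are determinants of `M` with one row replaced by a constant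
basis vector. -/
theorem SmoothMatOn.inv (hM : SmoothMatOn M U) (hdet : ∀ w ∈ U, (M w).det ≠ 0) :
    SmoothMatOn (fun w => (M w)⁻¹) U := fun k l => by
  simp only [Matrix.inv_def, Ring.inverse_eq_inv', Matrix.smul_apply, smul_eq_mul,
    Matrix.adjugate_apply]
  refine (hM.det.inv hdet).mul (SmoothMatOn.det fun i j => ?_)
  by_cases hi : i = l
  · subst hi; simpa using contDiffOn_const
  · simpa [hi] using hM i j

theorem wirtingerMat_congr (a : Fin n ⊕ Fin n) (h : M =ᶠ[nhds z] N) :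
    wirtingerMat a M z = wirtingerMat a N z := by
  ext k l
  exact wirtinger_congr a (h.mono fun w hw => by simp only [hw])

theorem wirtingerMat_const (a : Fin n ⊕ Fin n) (C : Matrix (Fin r) (Fin r) ℂ) :
    wirtingerMat a (fun _ => C) z = 0 := by
  ext k l; exact wirtinger_const a _

theorem wirtingerMat_add (a : Fin n ⊕ Fin n) (hM : DiffMatAt M z) (hN : DiffMatAt N z) :
    wirtingerMat a (fun w => M w + N w) z = wirtingerMat a M z + wirtingerMat a N z := by
  ext k l; exact wirtinger_add a (hM k l) (hN k l)

theorem DiffMatAt.mul (hM : DiffMatAt M z) (hN : DiffMatAt N z) :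
    DiffMatAt (fun w => M w * N w) z := fun k l => by
  simp only [Matrix.mul_apply]
  exact DifferentiableAt.fun_sum fun j _ => (hM k j).fun_mul (hN j l)

theorem wirtingerMat_mul (a : Fin n ⊕ Fin n) (hM : DiffMatAt M z) (hN : DiffMatAt N z) :
    wirtingerMat a (fun w => M w * N w) z =
      wirtingerMat a M z * N z + M z * wirtingerMat a N z := by
  ext k l
  simp only [wirtingerMat, Matrix.of_apply, Matrix.mul_apply, Matrix.add_apply]
  rw [wirtinger_sum a _ fun j _ => (hM k j).fun_mul (hN j l), ← Finset.sum_add_distrib]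
  exact Finset.sum_congr rfl fun j _ => wirtinger_mul a (hM k j) (hN j l)

theorem wirtingerMat_inv (a : Fin n ⊕ Fin n) (hU : IsOpen U) (hM : SmoothMatOn M U)
    (hdet : ∀ w ∈ U, (M w).det ≠ 0) (hz : z ∈ U) :
    wirtingerMat a (fun w => (M w)⁻¹) z = -((M z)⁻¹ * wirtingerMat a M z * (M z)⁻¹) := by
  have hu : ∀ w ∈ U, IsUnit (M w).det := fun w hw => (hdet w hw).isUnit
  -- Differentiating M⁻¹M = 1 determines the derivative of M⁻¹.
  have h1 : wirtingerMat a (fun w => (M w)⁻¹ * M w) z = 0 := by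
    rw [← wirtingerMat_const a (1 : Matrix (Fin r) (Fin r) ℂ) (z := z)]
    exact wirtingerMat_congr a (Filter.eventually_of_mem (hU.mem_nhds hz)
      fun w hw => Matrix.nonsing_inv_mul _ (hu w hw))
  rw [wirtingerMat_mul a ((hM.inv hdet).diffMatAt hU hz) (hM.diffMatAt hU hz)] at h1
  have h2 := congrArg (· * (M z)⁻¹) h1
  simp only [add_mul, zero_mul, mul_assoc, Matrix.mul_nonsing_inv _ (hu z hz), mul_one] at h2
  rw [eq_neg_iff_add_eq_zero, mul_assoc]
  exact h2

theorem wirtingerMat_conjTranspose (a : Fin n ⊕ Fin n) (hM : DiffMatAt M z) :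
    wirtingerMat a (fun w => (M w).conjTranspose) z =
      (wirtingerMat a.swap M z).conjTranspose := by
  ext k l; exact wirtinger_conj a (hM l k)

theorem DiffMatAt.conjTranspose (hM : DiffMatAt M z) :
    DiffMatAt (fun w => (M w).conjTranspose) z := fun k l =>
  (Complex.conjCLE.toContinuousLinearMap.hasFDerivAt.comp z (hM l k).hasFDerivAt).differentiableAt

theorem wirtingerMat_comm (a b : Fin n ⊕ Fin n) (hU : IsOpen U) (hM : SmoothMatOn M U)
    (hz : z ∈ U) :
    wirtingerMat a (wirtingerMat b M) z = wirtingerMat b (wirtingerMat a M) z := by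
  ext k l; exact wirtinger_comm a b ((hM k l).contDiffAt (hU.mem_nhds hz))

end WirtingerMat

/-! ### Curvature in a holomorphic frame -/

/-! ### Algebra of the adjoint with respect to a Gram matrix. -/

section Adjoint

variable {r : ℕ} {G : Matrix (Fin r) (Fin r) ℂ}

theorem adjointMat_mul (hdet : G.det ≠ 0) (M N : Matrix (Fin r) (Fin r) ℂ) :
    adjointMat G (M * N) = adjointMat G N * adjointMat G M := by
  simp only [adjointMat, Matrix.conjTranspose_mul, mul_assoc]
  rw [Matrix.mul_nonsing_inv_cancel_left _ _ hdet.isUnit]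

theorem adjointMat_adjointMat (hdet : G.det ≠ 0) (hG : G.conjTranspose = G)
    (M : Matrix (Fin r) (Fin r) ℂ) : adjointMat G (adjointMat G M) = M := by
  simp only [adjointMat, Matrix.conjTranspose_mul, Matrix.conjTranspose_nonsing_inv, hG,
    Matrix.conjTranspose_conjTranspose, mul_assoc, Matrix.nonsing_inv_mul _ hdet.isUnit, mul_one]
  rw [Matrix.nonsing_inv_mul_cancel_left _ _ hdet.isUnit]

theorem adjointMat_add (M N : Matrix (Fin r) (Fin r) ℂ) :
    adjointMat G (M + N) = adjointMat G M + adjointMat G N := by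
  simp only [adjointMat, Matrix.conjTranspose_add, mul_add, add_mul]

theorem adjointMat_sub (M N : Matrix (Fin r) (Fin r) ℂ) :
    adjointMat G (M - N) = adjointMat G M - adjointMat G N := by
  simp only [adjointMat, Matrix.conjTranspose_sub, mul_sub, sub_mul]

theorem adjointMat_smul (c : ℂ) (M : Matrix (Fin r) (Fin r) ℂ) :
    adjointMat G (c • M) = star c • adjointMat G M := by
  simp only [adjointMat, Matrix.conjTranspose_smul, mul_smul_comm, smul_mul_assoc]

theorem adjointMat_sum {ι : Type*} (s : Finset ι) (M : ι → Matrix (Fin r) (Fin r) ℂ) :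
    adjointMat G (∑ i ∈ s, M i) = ∑ i ∈ s, adjointMat G (M i) := by
  simp only [adjointMat, Matrix.conjTranspose_sum, Finset.mul_sum, Finset.sum_mul]

end Adjoint

section Bundle

variable {n r : ℕ} {X : Type*} [TopologicalSpace X] [ChartedSpace (Fin n → ℂ) X]
  {V : X → Type*} [TopologicalSpace (Bundle.TotalSpace (Fin r → ℂ) V)]
  [∀ x, AddCommGroup (V x)] [∀ x, Module ℂ (V x)] [∀ x, TopologicalSpace (V x)]
  [FiberBundle (Fin r → ℂ) V]

omit [∀ x, AddCommGroup (V x)] [∀ x, Module ℂ (V x)] in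
theorem isOpen_patchImage (i : X) : IsOpen (patchImage n r V i) :=
  (chartAt (Fin n → ℂ) i).isOpen_inter_preimage_symm
    (trivializationAt (Fin r → ℂ) V i).open_baseSet

theorem HermitianMetric.gram_conjTranspose (h : HermitianMetric n r V) (i : X) (z : Fin n → ℂ) :
    (h.gram i z).conjTranspose = h.gram i z := by
  ext k l
  exact h.conj_symm _ _ _

theorem HermitianMetric.smoothMatOn_gram (h : HermitianMetric n r V) (i : X) :
    SmoothMatOn (h.gram i) (patchImage n r V i) := fun k l => h.smooth i l k

variable [VectorBundle ℂ (Fin r → ℂ) V]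

theorem frame_eq_linearEquivAt_symm {i x : X}
    (hx : x ∈ (trivializationAt (Fin r → ℂ) V i).baseSet) (k : Fin r) :
    frame V i x k =
      ((trivializationAt (Fin r → ℂ) V i).linearEquivAt ℂ x hx).symm (Pi.single k 1) := rfl

/-- A nonzero kernel vector of the Gram matrix would represent a nonzero vector of the fibre of
length zero. -/
theorem HermitianMetric.det_gram_ne_zero (h : HermitianMetric n r V) (i : X) {z : Fin n → ℂ}
    (hz : z ∈ patchImage n r V i) : (h.gram i z).det ≠ 0 := by
  intro h0
  obtain ⟨s, hs, hGs⟩ := Matrix.exists_mulVec_eq_zero_iff.2 h0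
  set x := (chartAt (Fin n → ℂ) i).symm z with hx
  set e := (trivializationAt (Fin r → ℂ) V i).linearEquivAt ℂ x hz.2
  have hS : e.symm s = ∑ k, s k • frame V i x k := by
    conv_lhs => rw [pi_eq_sum_univ' s]
    simp only [map_sum, map_smul]
    refine Finset.sum_congr rfl fun k _ => ?_
    rw [frame_eq_linearEquivAt_symm hz.2]
  have hpos := h.pos x (e.symm s) (by simpa using hs)
  have hzero : h.form x (e.symm s) (e.symm s) = 0 := by
    conv_lhs => enter [2]; rw [hS]
    simp only [map_sum, LinearMap.map_smulₛₗ, smul_eq_mul]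
    refine Finset.sum_eq_zero fun k _ => ?_
    have h1 := congrFun hGs k
    rw [hS]
    simp only [map_sum, map_smul, LinearMap.sum_apply, LinearMap.smul_apply, smul_eq_mul]
    simp only [Matrix.mulVec, dotProduct, HermitianMetric.gram, Matrix.of_apply,
      Pi.zero_apply] at h1
    rw [← hx] at h1
    simp only [mul_comm (s _)]
    rw [h1, mul_zero]
  rw [hzero] at hpos
  simp at hpos

/-! ### Type and symmetry of the Chern curvature. -/

section Chern

variable (h : HermitianMetric n r V) {i : X} {z : Fin n → ℂ}

theorem HermitianMetric.smoothMatOn_gram_inv (i : X) :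
    SmoothMatOn (fun w => (h.gram i w)⁻¹) (patchImage n r V i) :=
  (h.smoothMatOn_gram i).inv fun _ hw => h.det_gram_ne_zero i hw

theorem HermitianMetric.smoothMatOn_chernConnection (i : X) (α : Fin n) :
    SmoothMatOn (h.chernConnection i (Sum.inl α)) (patchImage n r V i) :=
  (h.smoothMatOn_gram_inv i).mul ((h.smoothMatOn_gram i).wirtingerMat (isOpen_patchImage i) _)

omit [VectorBundle ℂ (Fin r → ℂ) V] in
theorem HermitianMetric.chernCurvature_inl_inr (i : X) (z : Fin n → ℂ) (α β : Fin n) :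
    curvature (h.chernConnection i) z (Sum.inl α) (Sum.inr β) =
      -wirtingerMat (Sum.inr β) (h.chernConnection i (Sum.inl α)) z := by
  simp [curvature, HermitianMetric.chernConnection, wirtingerMat_const]

/-- Taking `a` of type (0,1) gives the (1,1)-curvature; taking it of type (1,0) serves the vanishing
of the (2,0)-part. -/
theorem HermitianMetric.wirtingerMat_chernConnection (hz : z ∈ patchImage n r V i)
    (a : Fin n ⊕ Fin n) (α : Fin n) :
    wirtingerMat a (h.chernConnection i (Sum.inl α)) z =
      (h.gram i z)⁻¹ * wirtingerMat a (wirtingerMat (Sum.inl α) (h.gram i)) z -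
      (h.gram i z)⁻¹ * wirtingerMat a (h.gram i) z * (h.gram i z)⁻¹ *
        wirtingerMat (Sum.inl α) (h.gram i) z := by
  have hU := isOpen_patchImage (n := n) (r := r) (V := V) i
  have hG := h.smoothMatOn_gram i
  change wirtingerMat a (fun w => (h.gram i w)⁻¹ * wirtingerMat (Sum.inl α) (h.gram i) w) z = _
  rw [wirtingerMat_mul a ((h.smoothMatOn_gram_inv i).diffMatAt hU hz)
    ((hG.wirtingerMat hU _).diffMatAt hU hz),
    wirtingerMat_inv a hU hG (fun _ hw => h.det_gram_ne_zero i hw) hz]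
  noncomm_ring

/-- Since G is Hermitian, (∂_α G)† = ∂̄_α G, and the mixed second derivatives commute. Both terms of
the curvature have the form G⁻¹Y, whose adjoint is G⁻¹Y†. -/
theorem HermitianMetric.adjointMat_chernCurvature (hz : z ∈ patchImage n r V i) (α β : Fin n) :
    adjointMat (h.gram i z) (curvature (h.chernConnection i) z (Sum.inl α) (Sum.inr β)) =
      curvature (h.chernConnection i) z (Sum.inl β) (Sum.inr α) := by
  have hU := isOpen_patchImage (n := n) (r := r) (V := V) i
  have hG := h.smoothMatOn_gram i
  have hdet : IsUnit (h.gram i z).det := (h.det_gram_ne_zero i hz).isUnit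
  have hstar : (fun w => (h.gram i w).conjTranspose) = h.gram i :=
    funext fun w => h.gram_conjTranspose i w
  have h1 : ∀ a, ∀ w ∈ patchImage n r V i, (wirtingerMat a (h.gram i) w).conjTranspose =
      wirtingerMat a.swap (h.gram i) w := fun a w hw => by
    have := wirtingerMat_conjTranspose a.swap (hG.diffMatAt hU hw)
    rw [hstar, Sum.swap_swap] at this
    exact this.symm
  have h2 : (wirtingerMat (Sum.inr β) (wirtingerMat (Sum.inl α) (h.gram i)) z).conjTranspose =
      wirtingerMat (Sum.inr α) (wirtingerMat (Sum.inl β) (h.gram i)) z := by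
    have := wirtingerMat_conjTranspose (Sum.inl β)
      ((hG.wirtingerMat hU (Sum.inl α)).diffMatAt hU hz)
    rw [Sum.swap_inl] at this
    rw [← this, wirtingerMat_comm (Sum.inr α) _ hU hG hz]
    exact wirtingerMat_congr _ (Filter.eventually_of_mem (hU.mem_nhds hz) fun w hw => h1 _ w hw)
  rw [h.chernCurvature_inl_inr, h.chernCurvature_inl_inr, h.wirtingerMat_chernConnection hz,
    h.wirtingerMat_chernConnection hz]
  simp only [adjointMat, Matrix.conjTranspose_neg, Matrix.conjTranspose_sub,
    Matrix.conjTranspose_mul, Matrix.conjTranspose_nonsing_inv, h.gram_conjTranspose, h1 _ z hz, h2,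
    Sum.swap_inl, Sum.swap_inr, mul_assoc, mul_neg, neg_mul, mul_sub, sub_mul,
    Matrix.nonsing_inv_mul _ hdet, mul_one]

/-- The second derivatives of G cancel by symmetry, and the derivatives of G⁻¹ cancel the commutator
of the connection matrices. -/
theorem HermitianMetric.chernCurvature_inl_inl (hz : z ∈ patchImage n r V i) (α β : Fin n) :
    curvature (h.chernConnection i) z (Sum.inl α) (Sum.inl β) = 0 := by
  have hU := isOpen_patchImage (n := n) (r := r) (V := V) i
  rw [curvature, h.wirtingerMat_chernConnection hz, h.wirtingerMat_chernConnection hz,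
    wirtingerMat_comm (Sum.inl α) _ hU (h.smoothMatOn_gram i) hz]
  simp only [HermitianMetric.chernConnection]
  noncomm_ring

omit [VectorBundle ℂ (Fin r → ℂ) V] in
theorem HermitianMetric.chernCurvature_inr_inr (i : X) (z : Fin n → ℂ) (α β : Fin n) :
    curvature (h.chernConnection i) z (Sum.inr α) (Sum.inr β) = 0 := by
  simp [curvature, HermitianMetric.chernConnection, wirtingerMat_const]

theorem curvature_swap (A : Fin n ⊕ Fin n → (Fin n → ℂ) → Matrix (Fin r) (Fin r) ℂ)
    (z : Fin n → ℂ) (a b : Fin n ⊕ Fin n) : curvature A z b a = -curvature A z a b := by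
  simp only [curvature]; abel

theorem dCoord_mul_swap (a b : Fin n ⊕ Fin n) :
    (dCoord a * dCoord b : Forms n) = -(dCoord b * dCoord a) := by
  rcases a with a | a <;> rcases b with b | b <;> exact ι_mul_swap _ _

theorem HermitianMetric.chernCurvature_eq_twoForm11 (hz : z ∈ patchImage n r V i) :
    h.chernCurvature i z = twoForm11 (curvature (h.chernConnection i) z) := by
  refine Matrix.ext fun k l => ?_
  simp only [HermitianMetric.chernCurvature, twoForm, twoForm11, Matrix.of_apply,
    Fintype.sum_sum_type, h.chernCurvature_inl_inl hz, h.chernCurvature_inr_inr,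
    Matrix.zero_apply, zero_smul, Finset.sum_const_zero, zero_add, add_zero]
  -- Components and wedge are both antisymmetric, so the two mixed blocks agree; the doubling
  -- cancels the ½ in `twoForm`.
  have h1 : ∑ α, ∑ β, curvature (h.chernConnection i) z (Sum.inr α) (Sum.inl β) k l •
      (dCoord (Sum.inr α) * dCoord (Sum.inl β) : Forms n) =
      ∑ α, ∑ β, curvature (h.chernConnection i) z (Sum.inl α) (Sum.inr β) k l •
      (dCoord (Sum.inl α) * dCoord (Sum.inr β) : Forms n) := by
    rw [Finset.sum_comm]
    refine Finset.sum_congr rfl fun α _ => Finset.sum_congr rfl fun β _ => ?_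
    rw [curvature_swap _ _ (Sum.inl α), dCoord_mul_swap (Sum.inr β), Matrix.neg_apply, neg_smul_neg]
  rw [h1, ← two_smul ℂ, smul_smul]
  norm_num

end Chern

/-! ### The Hitchin–Simpson curvature. -/

section Higgs

variable [IsManifold 𝓘(ℂ, Fin n → ℂ) ω X] (φ : HiggsField n r V) (h : HermitianMetric n r V)
  {i : X} {z : Fin n → ℂ}

theorem HiggsField.mat_eq_toMatrix' (hz : z ∈ patchImage n r V i) (α : Fin n) :
    φ.mat i α z = LinearMap.toMatrix'
      (((trivializationAt (Fin r → ℂ) V i).linearEquivAt ℂ _ hz.2).conj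
        (φ.toFun ((chartAt (Fin n → ℂ) i).symm z)
          (frame (TangentSpace 𝓘(ℂ, Fin n → ℂ) : X → Type) i
            ((chartAt (Fin n → ℂ) i).symm z) α))) := by
  ext k l
  rw [LinearMap.toMatrix'_apply, LinearEquiv.conj_apply_apply]
  simp only [HiggsField.mat, Matrix.of_apply, frame_eq_linearEquivAt_symm hz.2]
  congr

theorem HiggsField.commute_mat (hz : z ∈ patchImage n r V i) (α β : Fin n) :
    φ.mat i α z * φ.mat i β z = φ.mat i β z * φ.mat i α z := by
  rw [φ.mat_eq_toMatrix' hz, φ.mat_eq_toMatrix' hz, ← LinearMap.toMatrix'_mul,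
    ← LinearMap.toMatrix'_mul, Module.End.mul_eq_comp, Module.End.mul_eq_comp,
    ← LinearEquiv.conj_comp, ← LinearEquiv.conj_comp, ← Module.End.mul_eq_comp, φ.wedge_self]
  rfl

omit [VectorBundle ℂ (Fin r → ℂ) V] in
theorem HiggsField.differentiableAt_mat (hz : z ∈ patchImage n r V i) (α : Fin n) (k l : Fin r) :
    DifferentiableAt ℂ (fun w => φ.mat i α w k l) z :=
  (φ.holomorphic i α k l).differentiableAt ((isOpen_patchImage i).mem_nhds hz)

omit [VectorBundle ℂ (Fin r → ℂ) V] in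
theorem HiggsField.diffMatAt_mat (hz : z ∈ patchImage n r V i) (α : Fin n) :
    DiffMatAt (φ.mat i α) z := fun k l =>
  (φ.differentiableAt_mat hz α k l).restrictScalars ℝ

omit [VectorBundle ℂ (Fin r → ℂ) V] in
theorem HiggsField.wirtingerMat_inr_mat (hz : z ∈ patchImage n r V i) (α β : Fin n) :
    wirtingerMat (Sum.inr β) (φ.mat i α) z = 0 := by
  ext k l
  exact wirtinger_inr_of_differentiableAt β (φ.differentiableAt_mat hz α k l)

theorem HiggsField.hsCurvature_inl_inr (hz : z ∈ patchImage n r V i) (α β : Fin n) :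
    φ.hsCurvature h i z (Sum.inl α) (Sum.inr β) =
      curvature (h.chernConnection i) z (Sum.inl α) (Sum.inr β) +
        (φ.mat i α z * adjointMat (h.gram i z) (φ.mat i β z) -
          adjointMat (h.gram i z) (φ.mat i β z) * φ.mat i α z) := by
  have hU := isOpen_patchImage (n := n) (r := r) (V := V) i
  have hG := h.smoothMatOn_gram i
  have hGd := hG.diffMatAt hU hz
  have hφ := φ.diffMatAt_mat hz
  have hdet : IsUnit (h.gram i z).det := (h.det_gram_ne_zero i hz).isUnit
  have hA : wirtingerMat (Sum.inr β) (φ.hsConnection h i (Sum.inl α)) z =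
      wirtingerMat (Sum.inr β) (h.chernConnection i (Sum.inl α)) z := by
    change wirtingerMat (Sum.inr β)
      (fun w => h.chernConnection i (Sum.inl α) w + φ.mat i α w) z = _
    rw [wirtingerMat_add _ ((h.smoothMatOn_chernConnection i α).diffMatAt hU hz) (hφ α),
      φ.wirtingerMat_inr_mat hz, add_zero]
  -- In φ* = G⁻¹φ†G the factor φ† is antiholomorphic, so only G is differentiated. The result is the
  -- commutator of φ* with the connection matrix, which cancels against the quadratic terms of the
  -- curvature.
  have hB : wirtingerMat (Sum.inl α) (φ.hsConnection h i (Sum.inr β)) z =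
      adjointMat (h.gram i z) (φ.mat i β z) * h.chernConnection i (Sum.inl α) z -
        h.chernConnection i (Sum.inl α) z * adjointMat (h.gram i z) (φ.mat i β z) := by
    have h1 : φ.hsConnection h i (Sum.inr β) = fun w =>
        (h.gram i w)⁻¹ * (φ.mat i β w).conjTranspose * h.gram i w :=
      funext fun w => zero_add _
    have hGi := (h.smoothMatOn_gram_inv i).diffMatAt hU hz
    rw [h1, wirtingerMat_mul _ (hGi.mul (hφ β).conjTranspose) hGd,
      wirtingerMat_mul _ hGi (hφ β).conjTranspose, wirtingerMat_conjTranspose _ (hφ β),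
      Sum.swap_inl, φ.wirtingerMat_inr_mat hz,
      wirtingerMat_inv _ hU hG (fun _ hw => h.det_gram_ne_zero i hw) hz]
    simp only [HermitianMetric.chernConnection, adjointMat, Matrix.conjTranspose_zero, mul_zero,
      add_zero, neg_mul, mul_assoc, Matrix.mul_nonsing_inv_cancel_left _ _ hdet]
    abel
  rw [HiggsField.hsCurvature, curvature, hA, hB, h.chernCurvature_inl_inr]
  simp only [HiggsField.hsConnection, HermitianMetric.chernConnection]
  noncomm_ring

theorem HiggsField.adjointMat_hsCurvature (hz : z ∈ patchImage n r V i) (α β : Fin n) :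
    adjointMat (h.gram i z) (φ.hsCurvature h i z (Sum.inl α) (Sum.inr β)) =
      φ.hsCurvature h i z (Sum.inl β) (Sum.inr α) := by
  have hdet := h.det_gram_ne_zero i hz
  rw [φ.hsCurvature_inl_inr h hz, φ.hsCurvature_inl_inr h hz, adjointMat_add, adjointMat_sub,
    adjointMat_mul hdet, adjointMat_mul hdet,
    adjointMat_adjointMat hdet (h.gram_conjTranspose i z), h.adjointMat_chernCurvature hz]

end Higgs

end Bundle

/-! ### Matrices of forms -/

section MatrixForms

variable {n r : ℕ}

section Entries

variable {A ι : Type*} [Ring A] [Fintype ι] {M N N' : Matrix ι ι A}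

theorem trace_mul_of_commute (h : ∀ k l p q, Commute (M k l) (N p q)) :
    (M * N).trace = (N * M).trace := by
  simp only [Matrix.trace, Matrix.diag_apply, Matrix.mul_apply]
  rw [Finset.sum_comm]
  exact Finset.sum_congr rfl fun _ _ => Finset.sum_congr rfl fun _ _ => h _ _ _ _

/-- Graded cyclicity of the trace for two odd matrices. -/
theorem trace_mul_of_anticommute (h : ∀ k l p q, M k l * N p q = -(N p q * M k l)) :
    (M * N).trace = -(N * M).trace := by
  simp only [Matrix.trace, Matrix.diag_apply, Matrix.mul_apply, ← Finset.sum_neg_distrib]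
  rw [Finset.sum_comm]
  exact Finset.sum_congr rfl fun _ _ => Finset.sum_congr rfl fun _ _ => h _ _ _ _

theorem commute_mul_apply {a : A} (h : ∀ k l, a * N k l = -(N k l * a))
    (h' : ∀ k l, a * N' k l = -(N' k l * a)) (k l : ι) : a * (N * N') k l = (N * N') k l * a := by
  simp only [Matrix.mul_apply, Finset.mul_sum, Finset.sum_mul]
  refine Finset.sum_congr rfl fun j _ => ?_
  rw [← mul_assoc, h, neg_mul, mul_assoc, h', mul_neg, neg_neg, mul_assoc]

theorem anticommute_mul_apply {a : A} (h : ∀ k l, a * N k l = N k l * a)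
    (h' : ∀ k l, a * N' k l = -(N' k l * a)) (k l : ι) :
    a * (N * N') k l = -((N * N') k l * a) := by
  simp only [Matrix.mul_apply, Finset.mul_sum, Finset.sum_mul, ← Finset.sum_neg_distrib]
  refine Finset.sum_congr rfl fun j _ => ?_
  rw [← mul_assoc, h, mul_assoc, h', mul_neg, mul_assoc]

end Entries

theorem oneForm_mul_apply (A B : Fin n ⊕ Fin n → Matrix (Fin r) (Fin r) ℂ) (k l : Fin r) :
    (oneForm A * oneForm B) k l =
      ∑ a, ∑ b, (A a * B b) k l • (dCoord a * dCoord b : Forms n) := by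
  simp only [oneForm, Matrix.mul_apply, Matrix.of_apply, Finset.sum_mul, Finset.mul_sum,
    smul_mul_smul_comm, Finset.sum_smul]
  rw [Finset.sum_comm]
  conv_rhs => rw [Finset.sum_comm]
  refine Finset.sum_congr rfl fun a _ => ?_
  rw [Finset.sum_comm]

theorem eq_zero_of_eq_neg_self {E : Type*} [AddCommGroup E] [Module ℂ E] {x : E} (h : x = -x) :
    x = 0 := by
  have h2 : (2 : ℂ) • x = 0 := by rw [two_smul]; exact add_eq_zero_iff_eq_neg.2 h
  exact (smul_eq_zero.1 h2).resolve_left two_ne_zero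

theorem oneForm_mul_self_of_commute {A : Fin n ⊕ Fin n → Matrix (Fin r) (Fin r) ℂ}
    (h : ∀ a b, A a * A b = A b * A a) : oneForm A * oneForm A = 0 := by
  refine Matrix.ext fun k l => eq_zero_of_eq_neg_self ?_
  rw [oneForm_mul_apply]
  conv_lhs => rw [Finset.sum_comm]
  simp only [← Finset.sum_neg_distrib]
  refine Finset.sum_congr rfl fun a _ => Finset.sum_congr rfl fun b _ => ?_
  rw [h b a, dCoord_mul_swap, smul_neg]

theorem oneForm_anticommute (A B : Fin n ⊕ Fin n → Matrix (Fin r) (Fin r) ℂ) (k l p q : Fin r) :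
    (oneForm A k l * oneForm B p q : Forms n) = -(oneForm B p q * oneForm A k l) := by
  simp only [oneForm, Matrix.of_apply, Finset.sum_mul, Finset.mul_sum, ← Finset.sum_neg_distrib]
  rw [Finset.sum_comm]
  refine Finset.sum_congr rfl fun a _ => Finset.sum_congr rfl fun b _ => ?_
  rw [smul_mul_smul_comm, smul_mul_smul_comm, dCoord_mul_swap, smul_neg, mul_comm]

/-- As P² = Q² = 0, the square is P(QPQ) + (QPQ)P. Both P and QPQ are odd, so the two traces are
opposite. -/
theorem trace_anticommutator_sq {A B : Fin n ⊕ Fin n → Matrix (Fin r) (Fin r) ℂ}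
    (hA : ∀ a b, A a * A b = A b * A a) (hB : ∀ a b, B a * B b = B b * B a) :
    ((oneForm A * oneForm B + oneForm B * oneForm A) *
      (oneForm A * oneForm B + oneForm B * oneForm A)).trace = 0 := by
  set P : Matrix (Fin r) (Fin r) (Forms n) := oneForm A with hP
  set Q : Matrix (Fin r) (Fin r) (Forms n) := oneForm B with hQ
  have hPP : P * P = 0 := oneForm_mul_self_of_commute hA
  have hQQ : Q * Q = 0 := oneForm_mul_self_of_commute hB
  have hexp : (P * Q + Q * P) * (P * Q + Q * P) = P * (Q * P * Q) + Q * P * Q * P := by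
    calc _ = P * (Q * P * Q) + P * (Q * Q) * P + Q * (P * P) * Q + Q * P * Q * P := by noncomm_ring
      _ = _ := by rw [hPP, hQQ]; simp
  rw [hexp, Matrix.trace_add, trace_mul_of_anticommute (N := Q * P * Q), neg_add_cancel]
  intro k l p q
  exact anticommute_mul_apply (commute_mul_apply (oneForm_anticommute A B k l)
    (oneForm_anticommute A A k l)) (oneForm_anticommute A B k l) p q

theorem trace_twoForm11_mul (F H : Fin n ⊕ Fin n → Fin n ⊕ Fin n → Matrix (Fin r) (Fin r) ℂ) :
    (twoForm11 F * twoForm11 H).trace = ∑ α, ∑ β, ∑ γ, ∑ δ,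
      (F (Sum.inl α) (Sum.inr β) * H (Sum.inl γ) (Sum.inr δ)).trace •
        (dCoord (Sum.inl α) * dCoord (Sum.inr β) *
          (dCoord (Sum.inl γ) * dCoord (Sum.inr δ)) : Forms n) := by
  simp only [Matrix.trace, Matrix.diag_apply, Matrix.mul_apply, twoForm11, Matrix.of_apply,
    Finset.sum_mul, Finset.mul_sum, smul_mul_smul_comm, Finset.sum_smul]
  have h4 : ∀ f : Fin r → Fin r → Fin n → Fin n → Fin n → Fin n → Forms n,
      ∑ k, ∑ l, ∑ γ, ∑ δ, ∑ α, ∑ β, f k l α β γ δ =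
        ∑ α, ∑ β, ∑ γ, ∑ δ, ∑ k, ∑ l, f k l α β γ δ := by
    intro f
    -- A single reindexing of the six-fold product replaces a chain of exchanges of sums.
    let e : (((((Fin r × Fin r) × Fin n) × Fin n) × Fin n) × Fin n) ≃
        (((((Fin n × Fin n) × Fin n) × Fin n) × Fin r) × Fin r) :=
      ⟨fun x => (((((x.1.2, x.2), x.1.1.1.2), x.1.1.2), x.1.1.1.1.1), x.1.1.1.1.2),
       fun x => (((((x.1.2, x.2), x.1.1.1.2), x.1.1.2), x.1.1.1.1.1), x.1.1.1.1.2),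
       fun _ => rfl, fun _ => rfl⟩
    have := Fintype.sum_equiv e
      (fun x => f x.1.1.1.1.1 x.1.1.1.1.2 x.1.2 x.2 x.1.1.1.2 x.1.1.2)
      (fun x => f x.1.2 x.2 x.1.1.1.1.1 x.1.1.1.1.2 x.1.1.1.2 x.1.1.2) fun _ => rfl
    simpa only [Fintype.sum_prod_type] using this
  exact h4 _

theorem commute_twoForm11 (F H : Fin n ⊕ Fin n → Fin n ⊕ Fin n → Matrix (Fin r) (Fin r) ℂ)
    (k l p q : Fin r) : Commute (twoForm11 F k l : Forms n) (twoForm11 H p q) := by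
  have hc : ∀ (α β γ δ : Fin n) (c d : ℂ),
      Commute (c • (dCoord (Sum.inl α) * dCoord (Sum.inr β)) : Forms n)
        (d • (dCoord (Sum.inl γ) * dCoord (Sum.inr δ))) := fun α β γ δ c d =>
    (((commute_ι_mul_ι _ _ _).mul_right (commute_ι_mul_ι _ _ _)).smul_right d).smul_left c
  simp only [twoForm11, Matrix.of_apply]
  exact Commute.sum_left _ _ _ fun α _ => Commute.sum_left _ _ _ fun β _ =>
    Commute.sum_right _ _ _ fun γ _ => Commute.sum_right _ _ _ fun δ _ => hc _ _ _ _ _ _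

theorem chernForm_one (Ω : Matrix (Fin r) (Fin r) (Forms n)) :
    chernForm 1 Ω = (Complex.I / (2 * Real.pi)) • Ω.trace := by
  simp only [chernForm, pow_one, Nat.factorial_one, Nat.cast_one, div_one]
  congr 1
  rw [← (Equiv.funUnique (Fin 1) (Fin r)).symm.sum_comp]
  simp [Matrix.trace]

theorem chernForm_two (Ω : Matrix (Fin r) (Fin r) (Forms n)) :
    chernForm 2 Ω = ((Complex.I / (2 * Real.pi)) ^ 2 / 2) •
      (Ω.trace ^ 2 - (Ω * Ω).trace) := by
  have huniv : (Finset.univ : Finset (Equiv.Perm (Fin 2))) = {1, Equiv.swap 0 1} := by decide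
  have hne : (1 : Equiv.Perm (Fin 2)) ≠ Equiv.swap 0 1 := by decide
  simp only [chernForm, Nat.factorial_two, Nat.cast_ofNat]
  congr 1
  rw [← (finTwoArrowEquiv (Fin r)).symm.sum_comp, Fintype.sum_prod_type]
  simp only [huniv, Finset.sum_pair hne]
  simp [Matrix.trace, Matrix.mul_apply, sq, Finset.sum_mul_sum, Finset.sum_add_distrib,
    sub_eq_add_neg]

/-- The squares of the trace cancel, leaving -(i/2π)² tr Ω². -/
theorem two_chernForm_two_sub (Ω : Matrix (Fin r) (Fin r) (Forms n)) :
    2 * chernForm 2 Ω - chernForm 1 Ω ^ 2 = (1 / (4 * (Real.pi : ℂ) ^ 2)) • (Ω * Ω).trace := by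
  have h2 : ∀ x : Forms n, 2 * x = (2 : ℂ) • x := fun x => by rw [two_smul, two_mul]
  rw [chernForm_one, chernForm_two, h2, smul_pow, smul_smul, smul_sub, sub_right_comm]
  have hc : (2 * ((Complex.I / (2 * Real.pi)) ^ 2 / 2) : ℂ) = (Complex.I / (2 * Real.pi)) ^ 2 := by
    ring
  rw [hc, sub_self, zero_sub, ← neg_smul]
  congr 1
  rw [div_pow, Complex.I_sq]
  ring

end MatrixForms

/-! ### The contraction identity -/

section Contraction

variable {n : ℕ}

/-- No unitary coframe is needed. With b_α = ∑_β G_{βα} dz̄^β the form is i ∑ dz^α∧b_α, to which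
`wedge_mul_sum_pow` applies, and G⁻¹ expresses each dz̄^β through the b's. -/
theorem dCoord_wedge_pow (hn : 2 ≤ n) {G : Matrix (Fin n) (Fin n) ℂ} (hdet : G.det ≠ 0)
    (α β γ δ : Fin n) :
    (n * (n - 1) : ℂ) • (dCoord (Sum.inl α) * dCoord (Sum.inr β) *
        (dCoord (Sum.inl γ) * dCoord (Sum.inr δ)) *
        (Complex.I • ∑ α, ∑ β, G β α • (dCoord (Sum.inl α) * dCoord (Sum.inr β) : Forms n)) ^
          (n - 2)) =
      (G⁻¹ α δ * G⁻¹ γ β - G⁻¹ α β * G⁻¹ γ δ) •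
        (Complex.I • ∑ α, ∑ β, G β α • (dCoord (Sum.inl α) * dCoord (Sum.inr β) : Forms n)) ^ n := by
  set a : Fin n → Cotangent n := fun α =>
    LinearMap.proj (R := ℝ) (φ := fun _ : Fin n => ℂ) α with ha
  set c : Fin n → Cotangent n := fun α => Complex.conjAe.toLinearMap ∘ₗ
    LinearMap.proj (R := ℝ) (φ := fun _ : Fin n => ℂ) α with hc
  set b : Fin n → Cotangent n := fun α => ∑ β, G β α • c β with hb
  have hw : ∑ α, ∑ β, G β α • (dCoord (Sum.inl α) * dCoord (Sum.inr β) : Forms n) =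
      ∑ α, ExteriorAlgebra.ι ℂ (a α) * ExteriorAlgebra.ι ℂ (b α) := by
    refine Finset.sum_congr rfl fun α _ => ?_
    simp only [hb, map_sum, map_smul, Finset.mul_sum, mul_smul_comm]
    rfl
  have hinv : ∀ β, (dCoord (Sum.inr β) : Forms n) =
      ∑ μ, G⁻¹ μ β • ExteriorAlgebra.ι ℂ (b μ) := fun β => by
    simp only [hb, map_sum, map_smul, Finset.smul_sum, smul_smul]
    rw [Finset.sum_comm]
    simp only [← Finset.sum_smul, mul_comm (G⁻¹ _ _), ← Matrix.mul_apply,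
      Matrix.mul_nonsing_inv _ hdet.isUnit, Matrix.one_apply, ite_smul, one_smul, zero_smul,
      Finset.sum_ite_eq', Finset.mem_univ, if_true]
    rfl
  -- This sign reverses the order of the two contractions relative to `wedge_mul_sum_pow`.
  have hI : Complex.I ^ (n - 2) = -Complex.I ^ n := by
    obtain ⟨m, rfl⟩ : ∃ m, n = m + 2 := ⟨n - 2, by omega⟩
    rw [Nat.add_sub_cancel, pow_add, Complex.I_sq]; ring
  rw [hw, smul_pow, smul_pow, hI, hinv β, hinv δ]
  have hl : ∀ α, (dCoord (Sum.inl α) : Forms n) = ExteriorAlgebra.ι ℂ (a α) := fun _ => rfl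
  have key := wedge_mul_sum_pow hn a b
  set w := ∑ α, ExteriorAlgebra.ι ℂ (a α) * ExteriorAlgebra.ι ℂ (b α)
  simp only [hl, Finset.mul_sum, Finset.sum_mul, mul_smul_comm, smul_mul_assoc, Finset.smul_sum,
    smul_comm (n * (n - 1) : ℂ)]
  simp only [key, smul_smul]
  simp only [← Finset.sum_smul]
  congr 1
  simp only [sub_mul, mul_sub, Finset.sum_sub_distrib, ite_and, mul_ite, mul_zero, mul_one,
    Finset.sum_ite_eq, Finset.mem_univ, if_true]
  simp only [Finset.sum_ite_irrel, Finset.sum_ite_eq, Finset.sum_const_zero, Finset.mem_univ,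
    if_true]
  ring

end Contraction

/-! ### The pointwise identity -/

section Pointwise

variable {n r : ℕ} {X : Type*} [TopologicalSpace X] [ChartedSpace (Fin n → ℂ) X]
  {V : X → Type*} [TopologicalSpace (Bundle.TotalSpace (Fin r → ℂ) V)]
  [∀ x, AddCommGroup (V x)] [∀ x, Module ℂ (V x)] [∀ x, TopologicalSpace (V x)]
  [FiberBundle (Fin r → ℂ) V]
  [IsManifold 𝓘(ℂ, Fin n → ℂ) ω X] (φ : HiggsField n r V) (g : KahlerMetric n X)
  (h : HermitianMetric n r V) {i : X} {z : Fin n → ℂ}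

omit [∀ x, AddCommGroup (V x)] [∀ x, Module ℂ (V x)] in
-- Lets facts about `g`, known on the patch of the tangent bundle, be used on the patch of `V`.
theorem patchImage_subset_patchImage_tangent (i : X) : patchImage n r V i ⊆
    patchImage n n (TangentSpace 𝓘(ℂ, Fin n → ℂ) : X → Type) i := fun z hz => by
  refine ⟨hz.1, ?_⟩
  rw [Set.mem_preimage, TangentBundle.trivializationAt_baseSet]
  exact (chartAt (Fin n → ℂ) i).map_target hz.1

omit [∀ x, AddCommGroup (V x)] [∀ x, Module ℂ (V x)] in
theorem KahlerMetric.det_gram_ne_zero (hz : z ∈ patchImage n r V i) : (g.gram i z).det ≠ 0 :=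
  g.toHermitianMetric.det_gram_ne_zero i (patchImage_subset_patchImage_tangent i hz)

theorem KahlerMetric.star_inv (i : X) (z : Fin n → ℂ) (α β : Fin n) :
    star (g.inv i z α β) = g.inv i z β α := by
  have h1 : ((g.gram i z)⁻¹).conjTranspose = (g.gram i z)⁻¹ := by
    rw [Matrix.conjTranspose_nonsing_inv, g.gram_conjTranspose]
  exact congrFun (congrFun h1 β) α

omit [∀ x, AddCommGroup (V x)] [∀ x, Module ℂ (V x)] in
theorem KahlerMetric.trace_mul_wedge_kahlerForm_pow (hn : 2 ≤ n) (hz : z ∈ patchImage n r V i)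
    (F : Fin n ⊕ Fin n → Fin n ⊕ Fin n → Matrix (Fin r) (Fin r) ℂ) :
    (n * (n - 1) : ℂ) • ((twoForm11 F * twoForm11 F).trace * g.kahlerForm i z ^ (n - 2)) =
      (∑ α, ∑ β, ∑ γ, ∑ δ, (g.inv i z α δ * g.inv i z γ β - g.inv i z α β * g.inv i z γ δ) *
        (F (Sum.inl α) (Sum.inr β) * F (Sum.inl γ) (Sum.inr δ)).trace) • g.kahlerForm i z ^ n := by
  rw [trace_twoForm11_mul]
  simp only [Finset.sum_mul, Finset.smul_sum, Finset.sum_smul, smul_mul_assoc]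
  refine Finset.sum_congr rfl fun α _ => Finset.sum_congr rfl fun β _ =>
    Finset.sum_congr rfl fun γ _ => Finset.sum_congr rfl fun δ _ => ?_
  rw [smul_comm, KahlerMetric.kahlerForm,
    dCoord_wedge_pow hn (g.det_gram_ne_zero hz), smul_smul, mul_comm]
  rfl

variable [VectorBundle ℂ (Fin r → ℂ) V]

theorem HiggsField.adjointMat_meanCurvature (hz : z ∈ patchImage n r V i) :
    adjointMat (h.gram i z) (φ.meanCurvature g h i z) = φ.meanCurvature g h i z := by
  simp only [HiggsField.meanCurvature, adjointMat_sum, adjointMat_smul,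
    φ.adjointMat_hsCurvature h hz, g.star_inv]
  rw [Finset.sum_comm]

theorem HiggsField.meanCurvatureNormSq_eq (hz : z ∈ patchImage n r V i) :
    φ.meanCurvatureNormSq g h i z = ∑ α, ∑ β, ∑ γ, ∑ δ, g.inv i z α β * g.inv i z γ δ *
      (φ.hsCurvature h i z (Sum.inl α) (Sum.inr β) *
        φ.hsCurvature h i z (Sum.inl γ) (Sum.inr δ)).trace := by
  rw [HiggsField.meanCurvatureNormSq, φ.adjointMat_meanCurvature g h hz]
  simp only [HiggsField.meanCurvature, Finset.sum_mul, Finset.mul_sum, smul_mul_smul_comm,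
    Matrix.trace_sum, Matrix.trace_smul, smul_eq_mul]
  refine Finset.sum_congr rfl fun α _ => Finset.sum_congr rfl fun β _ =>
    Finset.sum_congr rfl fun γ _ => Finset.sum_congr rfl fun δ _ => ?_
  rw [Matrix.trace_mul_comm, mul_comm (g.inv i z γ δ)]

theorem HiggsField.curvature11NormSq_eq (hz : z ∈ patchImage n r V i) :
    φ.curvature11NormSq g h i z = ∑ α, ∑ β, ∑ γ, ∑ δ, g.inv i z α δ * g.inv i z γ β *
      (φ.hsCurvature h i z (Sum.inl α) (Sum.inr β) *
        φ.hsCurvature h i z (Sum.inl γ) (Sum.inr δ)).trace := by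
  simp only [HiggsField.curvature11NormSq, φ.adjointMat_hsCurvature h hz]
  -- Taking the adjoint exchanged γ and δ; exchanging the two sums renames them back.
  exact Finset.sum_congr rfl fun α _ => Finset.sum_congr rfl fun β _ => Finset.sum_comm

theorem HiggsField.normSq_sub_smul_kahlerForm_pow (hn : 2 ≤ n) (hz : z ∈ patchImage n r V i) :
    φ.curvature11NormSq g h i z • g.kahlerForm i z ^ n -
        φ.meanCurvatureNormSq g h i z • g.kahlerForm i z ^ n =
      (n * (n - 1) : ℂ) • ((φ.curvature11 h i z * φ.curvature11 h i z).trace *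
        g.kahlerForm i z ^ (n - 2)) := by
  rw [HiggsField.curvature11, g.trace_mul_wedge_kahlerForm_pow hn hz, ← sub_smul,
    φ.curvature11NormSq_eq g h hz, φ.meanCurvatureNormSq_eq g h hz]
  simp only [sub_mul, Finset.sum_sub_distrib]

omit [VectorBundle ℂ (Fin r → ℂ) V] in
theorem HiggsField.bracket_eq_twoForm11 (i : X) (z : Fin n → ℂ) :
    φ.bracket h i z = twoForm11 fun a b => Sum.elim
      (fun α => Sum.elim 0 (fun β => φ.mat i α z * adjointMat (h.gram i z) (φ.mat i β z) -
          adjointMat (h.gram i z) (φ.mat i β z) * φ.mat i α z) b) 0 a := by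
  refine Matrix.ext fun k l => ?_
  simp only [HiggsField.bracket, HiggsField.formMat, HiggsField.adjointFormMat, Matrix.add_apply,
    oneForm_mul_apply, twoForm11, Matrix.of_apply, Fintype.sum_sum_type, Sum.elim_inl,
    Sum.elim_inr, zero_mul, mul_zero, Matrix.zero_apply, zero_smul, Finset.sum_const_zero,
    add_zero, zero_add]
  conv_lhs => enter [2]; rw [Finset.sum_comm]
  simp only [← Finset.sum_add_distrib]
  refine Finset.sum_congr rfl fun α _ => Finset.sum_congr rfl fun β _ => ?_
  rw [dCoord_mul_swap (Sum.inr β), smul_neg, Matrix.sub_apply, sub_smul, sub_eq_add_neg]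

theorem HiggsField.curvature11_eq_add (hz : z ∈ patchImage n r V i) :
    φ.curvature11 h i z = h.chernCurvature i z + φ.bracket h i z := by
  rw [h.chernCurvature_eq_twoForm11 hz, φ.bracket_eq_twoForm11]
  refine Matrix.ext fun k l => ?_
  simp only [HiggsField.curvature11, twoForm11, Matrix.of_apply, Matrix.add_apply,
    φ.hsCurvature_inl_inr h hz, add_smul, Finset.sum_add_distrib, Sum.elim_inl, Sum.elim_inr]

theorem HiggsField.trace_bracket_sq (hz : z ∈ patchImage n r V i) :
    (φ.bracket h i z * φ.bracket h i z).trace = 0 := by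
  have hdet := h.det_gram_ne_zero i hz
  refine trace_anticommutator_sq ?_ ?_
  · rintro (a | a) (b | b) <;> simp [φ.commute_mat hz a b]
  · rintro (a | a) (b | b) <;> simp [← adjointMat_mul hdet, φ.commute_mat hz a b]

theorem HiggsField.trace_curvature11_sq (hz : z ∈ patchImage n r V i) :
    (φ.curvature11 h i z * φ.curvature11 h i z).trace =
      (h.chernCurvature i z * h.chernCurvature i z).trace +
        2 • (φ.curvature11 h i z * φ.bracket h i z).trace := by
  have hcomm : (φ.bracket h i z * h.chernCurvature i z).trace =
      (h.chernCurvature i z * φ.bracket h i z).trace := by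
    rw [h.chernCurvature_eq_twoForm11 hz, φ.bracket_eq_twoForm11]
    exact trace_mul_of_commute (commute_twoForm11 _ _)
  rw [φ.curvature11_eq_add h hz]
  simp only [add_mul, mul_add, Matrix.trace_add, φ.trace_bracket_sq h hz, hcomm]
  abel

end Pointwise

/-! ### Continuity of forms -/

section Continuity

variable {n r : ℕ} {U : Set (Fin n → ℂ)} {η θ : (Fin n → ℂ) → Forms n} {f : (Fin n → ℂ) → ℂ}

/-- A form is continuous on `U` if it is a finite combination of constant forms with
continuous coefficients. -/
def ContinuousFormOn (η : (Fin n → ℂ) → Forms n) (U : Set (Fin n → ℂ)) : Prop :=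
  ∃ (κ : Type) (_ : Fintype κ) (f : κ → (Fin n → ℂ) → ℂ) (e : κ → Forms n),
    (∀ j, ContinuousOn (f j) U) ∧ ∀ z ∈ U, η z = ∑ j, f j z • e j

theorem ContinuousFormOn.congr (h : ContinuousFormOn η U) (hθ : ∀ z ∈ U, θ z = η z) :
    ContinuousFormOn θ U := by
  obtain ⟨κ, _, f, e, hf, he⟩ := h
  exact ⟨κ, _, f, e, hf, fun z hz => (hθ z hz).trans (he z hz)⟩

theorem continuousFormOn_smul_const (hf : ContinuousOn f U) (e : Forms n) :
    ContinuousFormOn (fun z => f z • e) U :=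
  ⟨Unit, inferInstance, fun _ => f, fun _ => e, fun _ => hf, fun z _ => by simp⟩

theorem continuousFormOn_const (e : Forms n) : ContinuousFormOn (fun _ => e) U :=
  (continuousFormOn_smul_const (continuousOn_const (c := (1 : ℂ))) e).congr fun z _ => by simp

theorem ContinuousFormOn.add (hη : ContinuousFormOn η U) (hθ : ContinuousFormOn θ U) :
    ContinuousFormOn (fun z => η z + θ z) U := by
  obtain ⟨κ, _, f, e, hf, he⟩ := hη
  obtain ⟨κ', _, f', e', hf', he'⟩ := hθ
  refine ⟨κ ⊕ κ', inferInstance, Sum.elim f f', Sum.elim e e', ?_, fun z hz => ?_⟩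
  · rintro (j | j)
    exacts [hf j, hf' j]
  · simp [he z hz, he' z hz, Fintype.sum_sum_type]

theorem ContinuousFormOn.mul (hη : ContinuousFormOn η U) (hθ : ContinuousFormOn θ U) :
    ContinuousFormOn (fun z => η z * θ z) U := by
  obtain ⟨κ, _, f, e, hf, he⟩ := hη
  obtain ⟨κ', _, f', e', hf', he'⟩ := hθ
  refine ⟨κ × κ', inferInstance, fun j z => f j.1 z * f' j.2 z, fun j => e j.1 * e' j.2,
    fun j => (hf _).mul (hf' _), fun z hz => ?_⟩
  simp only [he z hz, he' z hz, Fintype.sum_prod_type, Finset.sum_mul_sum, smul_mul_smul_comm]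

theorem ContinuousFormOn.smul (hf : ContinuousOn f U) (hη : ContinuousFormOn η U) :
    ContinuousFormOn (fun z => f z • η z) U :=
  ((continuousFormOn_smul_const hf 1).mul hη).congr fun z _ => by simp

theorem ContinuousFormOn.sum {κ : Type*} (s : Finset κ) {η : κ → (Fin n → ℂ) → Forms n}
    (h : ∀ j ∈ s, ContinuousFormOn (η j) U) : ContinuousFormOn (fun z => ∑ j ∈ s, η j z) U := by
  classical
  induction s using Finset.induction_on with
  | empty => exact (continuousFormOn_const 0).congr fun z _ => by simp
  | insert a s ha ih =>
    exact ((h a (by simp)).add (ih fun j hj => h j (by simp [hj]))).congr fun z _ => by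
      rw [Finset.sum_insert ha]

theorem ContinuousFormOn.pow (h : ContinuousFormOn η U) (k : ℕ) :
    ContinuousFormOn (fun z => η z ^ k) U := by
  induction k with
  | zero => simpa using continuousFormOn_const 1
  | succ k ih => simpa only [pow_succ] using ih.mul h

/-- The purpose of `ContinuousFormOn`: applied to `topCoeff` it gives continuous integrands without
a topology on `Forms n`. -/
theorem ContinuousFormOn.continuousOn (h : ContinuousFormOn η U) (L : Forms n →ₗ[ℂ] ℂ) :
    ContinuousOn (fun z => L (η z)) U := by
  obtain ⟨κ, _, f, e, hf, he⟩ := h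
  refine ContinuousOn.congr (f := fun z => ∑ j, f j z * L (e j))
    (continuousOn_finsetSum _ fun j _ => (hf j).mul continuousOn_const) fun z hz => ?_
  simp [he z hz]

theorem continuousFormOn_trace_twoForm11_mul
    {F H : (Fin n → ℂ) → Fin n ⊕ Fin n → Fin n ⊕ Fin n → Matrix (Fin r) (Fin r) ℂ}
    (hF : ∀ α β, ContinuousOn (fun z => F z (Sum.inl α) (Sum.inr β)) U)
    (hH : ∀ α β, ContinuousOn (fun z => H z (Sum.inl α) (Sum.inr β)) U) :
    ContinuousFormOn (fun z => (twoForm11 (F z) * twoForm11 (H z)).trace) U := by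
  refine ContinuousFormOn.congr (ContinuousFormOn.sum _ fun α _ => ContinuousFormOn.sum _ fun β _ =>
    ContinuousFormOn.sum _ fun γ _ => ContinuousFormOn.sum _ fun δ _ =>
      continuousFormOn_smul_const
        (continuous_id.matrix_trace.comp_continuousOn ((hF α β).mul (hH γ δ))) _) fun z _ =>
      trace_twoForm11_mul _ _

theorem SmoothMatOn.continuousOn {M : (Fin n → ℂ) → Matrix (Fin r) (Fin r) ℂ}
    (h : SmoothMatOn M U) : ContinuousOn M U :=
  continuousOn_pi.2 fun k => continuousOn_pi.2 fun l => (h k l).continuousOn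

end Continuity

/-! ### Continuity of the geometric integrands on patches. -/

section BundleContinuity

variable {n r : ℕ} {X : Type*} [TopologicalSpace X] [ChartedSpace (Fin n → ℂ) X]
  {V : X → Type*} [TopologicalSpace (Bundle.TotalSpace (Fin r → ℂ) V)]
  [∀ x, AddCommGroup (V x)] [∀ x, Module ℂ (V x)] [∀ x, TopologicalSpace (V x)]
  [FiberBundle (Fin r → ℂ) V]
  [IsManifold 𝓘(ℂ, Fin n → ℂ) ω X] (φ : HiggsField n r V) (g : KahlerMetric n X)
  (h : HermitianMetric n r V) {i : X} {z : Fin n → ℂ}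

omit [∀ x, AddCommGroup (V x)] [∀ x, Module ℂ (V x)] in
theorem KahlerMetric.continuousOn_inv (i : X) (α β : Fin n) :
    ContinuousOn (fun z => g.inv i z α β) (patchImage n r V i) :=
  ((g.toHermitianMetric.smoothMatOn_gram_inv i) α β).continuousOn.mono
    (patchImage_subset_patchImage_tangent i)

omit [∀ x, AddCommGroup (V x)] [∀ x, Module ℂ (V x)] in
theorem KahlerMetric.continuousFormOn_kahlerForm (i : X) :
    ContinuousFormOn (g.kahlerForm i) (patchImage n r V i) :=
  ContinuousFormOn.smul continuousOn_const <| ContinuousFormOn.sum _ fun α _ =>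
    ContinuousFormOn.sum _ fun β _ => continuousFormOn_smul_const
      ((g.toHermitianMetric.smoothMatOn_gram i β α).continuousOn.mono
        (patchImage_subset_patchImage_tangent i)) _

theorem HiggsField.continuousOn_mat (i : X) (α : Fin n) :
    ContinuousOn (φ.mat i α) (patchImage n r V i) :=
  continuousOn_pi.2 fun k => continuousOn_pi.2 fun l => (φ.holomorphic i α k l).continuousOn

variable [VectorBundle ℂ (Fin r → ℂ) V]

omit [IsManifold 𝓘(ℂ, Fin n → ℂ) ω X] in
theorem HermitianMetric.continuousOn_chernCurvature (i : X) (α β : Fin n) :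
    ContinuousOn (fun z => curvature (h.chernConnection i) z (Sum.inl α) (Sum.inr β))
      (patchImage n r V i) := by
  simp only [h.chernCurvature_inl_inr]
  exact ((h.smoothMatOn_chernConnection i α).wirtingerMat (isOpen_patchImage i) _).continuousOn.neg

theorem HiggsField.continuousOn_commutator (i : X) (α β : Fin n) :
    ContinuousOn (fun z => φ.mat i α z * adjointMat (h.gram i z) (φ.mat i β z) -
      adjointMat (h.gram i z) (φ.mat i β z) * φ.mat i α z) (patchImage n r V i) := by
  have hadj : ContinuousOn (fun z => adjointMat (h.gram i z) (φ.mat i β z))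
      (patchImage n r V i) :=
    ((h.smoothMatOn_gram_inv i).continuousOn.mul
      (continuous_id.matrix_conjTranspose.comp_continuousOn (φ.continuousOn_mat i β))).mul
      (h.smoothMatOn_gram i).continuousOn
  exact ((φ.continuousOn_mat i α).mul hadj).sub (hadj.mul (φ.continuousOn_mat i α))

theorem HiggsField.continuousOn_hsCurvature (i : X) (α β : Fin n) :
    ContinuousOn (fun z => φ.hsCurvature h i z (Sum.inl α) (Sum.inr β)) (patchImage n r V i) :=
  ((h.continuousOn_chernCurvature i α β).add (φ.continuousOn_commutator h i α β)).congr
    fun _ hz => φ.hsCurvature_inl_inr h hz α β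

theorem HiggsField.continuousOn_sum_trace (i : X) {c : Fin n → Fin n → Fin n → Fin n →
    (Fin n → ℂ) → ℂ} (hc : ∀ α β γ δ, ContinuousOn (c α β γ δ) (patchImage n r V i)) :
    ContinuousOn (fun z => ∑ α, ∑ β, ∑ γ, ∑ δ, c α β γ δ z *
      (φ.hsCurvature h i z (Sum.inl α) (Sum.inr β) *
        φ.hsCurvature h i z (Sum.inl γ) (Sum.inr δ)).trace) (patchImage n r V i) :=
  continuousOn_finsetSum _ fun α _ => continuousOn_finsetSum _ fun β _ =>
    continuousOn_finsetSum _ fun γ _ => continuousOn_finsetSum _ fun δ _ =>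
      (hc α β γ δ).mul (continuous_id.matrix_trace.comp_continuousOn
        ((φ.continuousOn_hsCurvature h i α β).mul (φ.continuousOn_hsCurvature h i γ δ)))

theorem HiggsField.continuousOn_meanCurvatureNormSq (i : X) :
    ContinuousOn (φ.meanCurvatureNormSq g h i) (patchImage n r V i) :=
  (φ.continuousOn_sum_trace h i fun α β γ δ =>
    (g.continuousOn_inv i α β).mul (g.continuousOn_inv i γ δ)).congr
    fun _ hz => φ.meanCurvatureNormSq_eq g h hz

omit [IsManifold 𝓘(ℂ, Fin n → ℂ) ω X] in
theorem HermitianMetric.continuousFormOn_trace_chernCurvature_sq (i : X) :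
    ContinuousFormOn (fun z => (h.chernCurvature i z * h.chernCurvature i z).trace)
      (patchImage n r V i) :=
  (continuousFormOn_trace_twoForm11_mul (h.continuousOn_chernCurvature i)
    (h.continuousOn_chernCurvature i)).congr fun z hz => by
      rw [h.chernCurvature_eq_twoForm11 hz]

theorem HiggsField.continuousFormOn_trace_curvature11_mul_bracket (i : X) :
    ContinuousFormOn (fun z => (φ.curvature11 h i z * φ.bracket h i z).trace)
      (patchImage n r V i) := by
  simp only [φ.bracket_eq_twoForm11]
  exact continuousFormOn_trace_twoForm11_mul (φ.continuousOn_hsCurvature h i)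
    (φ.continuousOn_commutator h i)

end BundleContinuity

/-! ### Integration -/

section Integral

open MeasureTheory

variable {n r : ℕ} {X : Type*} [TopologicalSpace X] [ChartedSpace (Fin n → ℂ) X]
  {V : X → Type*} [TopologicalSpace (Bundle.TotalSpace (Fin r → ℂ) V)]
  [∀ x, AddCommGroup (V x)] [∀ x, Module ℂ (V x)] [∀ x, TopologicalSpace (V x)]
  [FiberBundle (Fin r → ℂ) V] [CompactSpace X] [T2Space X]
  {η θ : X → (Fin n → ℂ) → Forms n}

theorem finite_partition_ne_zero : {i : X | partition n r V i ≠ 0}.Finite :=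
  ((partition n r V).locallyFinite.finite_nonempty_of_compact).subset fun i hi => by
    obtain ⟨x, hx⟩ := DFunLike.ne_iff.1 hi
    exact ⟨x, hx⟩

/-- The patch image need not be compact and `f` may blow up at its boundary. The support of the
cutoff, however, is closed in compact X and lies in the patch, so its chart image is compact and the
product vanishes elsewhere on the patch image. -/
theorem integrableOn_partition_mul {i : X} {f : (Fin n → ℂ) → ℂ}
    (hf : ContinuousOn f (patchImage n r V i)) :
    IntegrableOn (fun z => ((partition n r V i ((chartAt (Fin n → ℂ) i).symm z) : ℝ) : ℂ) * f z)
      (patchImage n r V i) := by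
  set e := chartAt (Fin n → ℂ) i
  set S := tsupport (partition n r V i)
  have hS : S ⊆ patch n r V i := (exists_partition n r V).choose_spec i
  have hK : IsCompact (e '' S) := (isClosed_tsupport _).isCompact.image_of_continuousOn
    (e.continuousOn.mono fun x hx => (hS hx).1)
  have hKU : e '' S ⊆ patchImage n r V i := by
    rintro _ ⟨x, hx, rfl⟩
    refine ⟨e.map_source (hS hx).1, ?_⟩
    rw [Set.mem_preimage, e.left_inv (hS hx).1]
    exact (hS hx).2
  have hcont : ContinuousOn (fun z => ((partition n r V i (e.symm z) : ℝ) : ℂ) * f z)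
      (patchImage n r V i) :=
    (Complex.continuous_ofReal.comp_continuousOn
      ((partition n r V i).continuous.comp_continuousOn
        (e.continuousOn_symm.mono fun z hz => hz.1))).mul hf
  refine ((hcont.mono hKU).integrableOn_compact hK).of_forall_sdiff_eq_zero
    (isOpen_patchImage i).measurableSet fun z hz => ?_
  have hz0 : e.symm z ∉ S := fun hx => hz.2 ⟨e.symm z, hx, e.right_inv hz.1.1⟩
  rw [image_eq_zero_of_notMem_tsupport hz0, Complex.ofReal_zero, zero_mul]

/-- Needed because `finsum` is zero by default on infinite supports; this finiteness is what makes
the sum over patches additive. -/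
theorem finite_support_integral_summand (η : X → (Fin n → ℂ) → Forms n) :
    (Function.support fun i : X => ∫ z in patchImage n r V i,
      ((partition n r V i ((chartAt (Fin n → ℂ) i).symm z) : ℝ) : ℂ) *
        topCoeff n (η i z)).Finite :=
  (finite_partition_ne_zero (n := n) (r := r) (V := V)).subset fun i hi h0 => hi (by simp [h0])

theorem integral_congr (h : ∀ i, ∀ z ∈ patchImage n r V i, η i z = θ i z) :
    integral n r V η = integral n r V θ :=
  finsum_congr fun i => setIntegral_congr_fun (isOpen_patchImage i).measurableSet fun z hz => by
    simp only [h i z hz]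

theorem integral_add (hη : ∀ i, ContinuousFormOn (η i) (patchImage n r V i))
    (hθ : ∀ i, ContinuousFormOn (θ i) (patchImage n r V i)) :
    integral n r V (fun i z => η i z + θ i z) = integral n r V η + integral n r V θ := by
  rw [integral, integral, integral, ← finsum_add_distrib (finite_support_integral_summand η)
    (finite_support_integral_summand θ)]
  refine finsum_congr fun i => ?_
  rw [← MeasureTheory.integral_add (integrableOn_partition_mul ((hη i).continuousOn _))
    (integrableOn_partition_mul ((hθ i).continuousOn _))]
  simp only [map_add, mul_add]

theorem integral_smul (c : ℂ) (η : X → (Fin n → ℂ) → Forms n) :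
    integral n r V (fun i z => c • η i z) = c * integral n r V η := by
  rw [integral, integral, mul_finsum]
  refine finsum_congr fun i => ?_
  rw [← MeasureTheory.integral_const_mul]
  simp only [map_smul, smul_eq_mul, mul_left_comm]

end Integral

end HiggsKahler

end

/-! ### The integrated identity. -/

theorem mainTheorem3 {n r : ℕ} (hn : 2 ≤ n)
    {X : Type*} [TopologicalSpace X] [CompactSpace X] [T2Space X]
    [ChartedSpace (Fin n → ℂ) X] [IsManifold 𝓘(ℂ, Fin n → ℂ) ω X]
    {V : X → Type*} [TopologicalSpace (Bundle.TotalSpace (Fin r → ℂ) V)]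
    [∀ x, AddCommGroup (V x)] [∀ x, Module ℂ (V x)] [∀ x, TopologicalSpace (V x)]
    [FiberBundle (Fin r → ℂ) V] [VectorBundle ℂ (Fin r → ℂ) V]
    [ContMDiffVectorBundle ω (Fin r → ℂ) V 𝓘(ℂ, Fin n → ℂ)]
    (g : HiggsKahler.KahlerMetric n X) (φ : HiggsKahler.HiggsField n r V)
    (h : HiggsKahler.HermitianMetric n r V) :
    φ.functionalI g h - φ.functionalJ g h =
      2 * (Real.pi : ℂ) ^ 2 * n * (n - 1) *
        HiggsKahler.integral n r V (fun i z =>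
          (2 * HiggsKahler.chernForm 2 (h.chernCurvature i z) -
            HiggsKahler.chernForm 1 (h.chernCurvature i z) ^ 2) * g.kahlerForm i z ^ (n - 2)) +
      n * (n - 1) *
        HiggsKahler.integral n r V (fun i z =>
          (φ.curvature11 h i z * φ.bracket h i z).trace * g.kahlerForm i z ^ (n - 2)) := by
  open HiggsKahler in
  have hκ : ∀ k i, ContinuousFormOn (fun z => g.kahlerForm i z ^ k) (patchImage n r V i) :=
    fun k i => (g.continuousFormOn_kahlerForm i).pow k
  have hB : ∀ i, ContinuousFormOn (fun z => φ.meanCurvatureNormSq g h i z • g.kahlerForm i z ^ n)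
      (patchImage n r V i) := fun i =>
    ContinuousFormOn.smul (φ.continuousOn_meanCurvatureNormSq g h i) (hκ n i)
  have hC : ∀ i, ContinuousFormOn (fun z => (h.chernCurvature i z * h.chernCurvature i z).trace *
      g.kahlerForm i z ^ (n - 2)) (patchImage n r V i) := fun i =>
    (h.continuousFormOn_trace_chernCurvature_sq i).mul (hκ _ i)
  have hD : ∀ i, ContinuousFormOn (fun z => (φ.curvature11 h i z * φ.bracket h i z).trace *
      g.kahlerForm i z ^ (n - 2)) (patchImage n r V i) := fun i =>
    (φ.continuousFormOn_trace_curvature11_mul_bracket h i).mul (hκ _ i)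
  have hsmul : ∀ (c : ℂ) {η : X → (Fin n → ℂ) → Forms n},
      (∀ i, ContinuousFormOn (η i) (patchImage n r V i)) →
      ∀ i, ContinuousFormOn (fun z => c • η i z) (patchImage n r V i) :=
    fun c η hη i => ContinuousFormOn.smul continuousOn_const (hη i)
  have hchern : integral n r V (fun i z => (2 * chernForm 2 (h.chernCurvature i z) -
      chernForm 1 (h.chernCurvature i z) ^ 2) * g.kahlerForm i z ^ (n - 2)) =
      1 / (4 * (Real.pi : ℂ) ^ 2) * integral n r V (fun i z =>
        (h.chernCurvature i z * h.chernCurvature i z).trace * g.kahlerForm i z ^ (n - 2)) := by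
    rw [← integral_smul]
    simp only [two_chernForm_two_sub, smul_mul_assoc]
  -- Solving the pointwise identity for |ℛ|² ωⁿ means that additivity is applied only to the three
  -- forms shown continuous above.
  have hA : integral n r V (fun i z => φ.curvature11NormSq g h i z • g.kahlerForm i z ^ n) =
      integral n r V (fun i z => φ.meanCurvatureNormSq g h i z • g.kahlerForm i z ^ n) +
      (n * (n - 1) * integral n r V (fun i z =>
        (h.chernCurvature i z * h.chernCurvature i z).trace * g.kahlerForm i z ^ (n - 2)) +
      2 * (n * (n - 1)) * integral n r V (fun i z =>
        (φ.curvature11 h i z * φ.bracket h i z).trace * g.kahlerForm i z ^ (n - 2))) := by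
    rw [← integral_smul, ← integral_smul, ← integral_add (hsmul _ hC) (hsmul _ hD),
      ← integral_add hB fun i => (hsmul _ hC i).add (hsmul _ hD i)]
    refine integral_congr fun i z hz => ?_
    rw [← sub_eq_iff_eq_add', φ.normSq_sub_smul_kahlerForm_pow g h hn hz,
      φ.trace_curvature11_sq h hz, add_mul, smul_add, two_nsmul, add_mul, smul_add,
      mul_smul (2 : ℂ), two_smul ℂ]
  have hpi : (Real.pi : ℂ) ≠ 0 := Complex.ofReal_ne_zero.2 Real.pi_ne_zero
  rw [HiggsField.functionalI, HiggsField.functionalJ, hA, hchern]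
  field_simp
  ring
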